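/- Let $1<\alpha<2$, $p\in[1,\infty]$ and $M\in\mathbb R$. There is a constant $c_p$, depending only on $\alpha$, $p$ and $M$, with the following property. Let $X$ be a complex Banach space and let $A:D(A)\subset X\to X$ be sectorial of angle $\alpha\pi/2$. That is, $A$ is closed and densely defined, $\sigma(A)\cap\Sigma_{\alpha\pi/2}=\emptyset$ with $\Sigma_\theta=\{z\in\mathbb C: z\ne0,\ |\arg z|<\theta\}$, and $\{z(z-A)^{-1}: z\in\Sigma_{\alpha\pi/2}\}$ is bounded in $\mathcal B(X)$. Suppose that $M$ is a bound of this set. Let $\tau>0$, $t_n=n\tau$ and $v,w\in X$. For a sequence $(y^n)_{n\ge0}$ in $X$ put $\bar\partial_\tau^\alpha y^n=\tau^{-\alpha}\sum_{j=0}^n b_{n-j}y^j$, where $\sum_{j\ge0} b_j\xi^j=(1-\xi)^\alpha$. Let $(u^n)_{n\ge0}$ be a solution of the backward Euler scheme for $\partial_t^\alpha u=Au$, $u(0)=v$, $\partial_tu(0)=w$: $u^0=v$, and for all $n\ge1$, $u^n\in D(A)$ and $$D^n:=\bar\partial_\tau^\alpha(u-v-tw)^n=Au^n .$$ Write $\|(y^n)_{n=1}^N\|_{L^p(X)}=\big(\tau\sum_{n=1}^N\|y^n\|_X^p\big)^{1/p}$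 (the maximum of $\|y^n\|_X$ over $1\le n\le N$ if $p=\infty$) and $\|(y^n)_{n=1}^N\|_{L^{p,\infty}(X)}=\sup_{\lambda>0}\lambda\,\big|\{1\le n\le N:\|y^n\|_X>\lambda\}\big|^{1/p}\tau^{1/p}$. Let $\|\cdot\|_{(X,D(A))_{\theta,p}}$ be the real interpolation norm defined by the K-method, with the graph norm on $D(A)$; it is $+\infty$ off the space. For $p=\infty$ it is $\sup_{t>0}t^{-\theta}K(t,\cdot)$, also when $\theta=1$. Then, for every $N\ge0$: (i) if $1\le p<\frac1{\alpha-1}$, $$\|(D^n)_{n=1}^N\|_{L^p(X)}+\|(Au^n)_{n=1}^N\|_{L^p(X)}\le c_p\Big(\|v\|_{(X,D(A))_{1-\frac1{p\alpha},p}}+(N\tau)^{\frac1p-(\alpha-1)}\|w\|_X\Big);$$ (ii) if $\frac1{\alpha-1}<p\le\infty$, $$\|(D^n)_{n=1}^N\|_{L^p(X)}+\|(Au^n)_{n=1}^N\|_{L^p(X)}\le c_p\Big(\|v\|_{(X,D(A))_{1-\frac1{p\alpha},p}}+\|w\|_{(X,D(A))_{1-\frac1\alpha-\frac1{p\alpha},p}}\Big);$$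 (iii) if $p=\frac1{\alpha-1}$, $$\|(D^n)_{n=1}^N\|_{L^{p,\infty}(X)}+\|(Au^n)_{n=1}^N\|_{L^{p,\infty}(X)}\le c_p\Big(\|v\|_{(X,D(A))_{1-\frac1{p\alpha},p}}+\|w\|_X\Big).$$ -/

import Mathlib

open scoped ENNReal NNReal

noncomputable section

namespace FracBE

/-- The open sector `Σ_θ = {z ≠ 0 : |arg z| < θ}` in the complex plane. -/
def sector (θ : ℝ) : Set ℂ := {z | z ≠ 0 ∧ |z.arg| < θ}

section Operators

variable {X : Type*} [NormedAddCommGroup X] [NormedSpace ℂ X]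

/-- `R` is the bounded two-sided inverse `R(z; A) = (z - A)⁻¹` of `z - A : D(A) → X`. -/
structure IsResolvent (A : X →ₗ.[ℂ] X) (z : ℂ) (R : X →L[ℂ] X) : Prop where
  mem_domain : ∀ x, R x ∈ A.domain
  right_inv : ∀ x, z • R x - A ⟨R x, mem_domain x⟩ = x
  left_inv : ∀ x : A.domain, R (z • (x : X) - A x) = x

/-- The resolvent set `ρ(A)` of an unbounded operator. -/
def resolventSet (A : X →ₗ.[ℂ] X) : Set ℂ := {z | ∃ R : X →L[ℂ] X, IsResolvent A z R}

/-- The spectrum `σ(A)` of an unbounded operator. -/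
def spectrum (A : X →ₗ.[ℂ] X) : Set ℂ := (resolventSet A)ᶜ

/-- `M` is a bound, in operator norm, of the set `{z R(z; A) : z ∈ Σ_θ}`. -/
def ResolventBound (A : X →ₗ.[ℂ] X) (θ M : ℝ) : Prop :=
  ∀ z ∈ sector θ, ∀ R : X →L[ℂ] X, IsResolvent A z R → ‖z • R‖ ≤ M

/-- `A` is sectorial of angle `θ`: it is closed and densely defined, its spectrum lies in
`ℂ \ Σ_θ`, and `{z R(z; A) : z ∈ Σ_θ}` is bounded in `B(X)`. -/
structure IsSectorial (A : X →ₗ.[ℂ] X) (θ : ℝ) : Prop where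
  closed : A.IsClosed
  dense : Dense (A.domain : Set X)
  spectrum_subset : spectrum A ⊆ (sector θ)ᶜ
  bounded : ∃ M, ResolventBound A θ M

open Classical in
/-- The value `A x` for `x ∈ D(A)` (extended by `0` off the domain). -/
def opVal (A : X →ₗ.[ℂ] X) (x : X) : X := if h : x ∈ A.domain then A ⟨x, h⟩ else 0

/-- The K-functional of the couple `(X, D(A))`, where `D(A)` carries the graph norm
`‖b‖ + ‖A b‖`: the infimum of `‖a‖_X + t ‖b‖_{D(A)}` over all `x = a + b` with `b ∈ D(A)`. -/
def kFunctional (A : X →ₗ.[ℂ] X) (t : ℝ) (x : X) : ℝ :=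
  ⨅ b : A.domain, (‖x - b‖ + t * (‖(b : X)‖ + ‖A b‖))

open Classical in
/-- The norm of the real interpolation space `(X, D(A))_{θ,p}` (K-method), with value `∞` off
the space: `(∫₀^∞ (t^{-θ} K(t,x))^p dt/t)^{1/p}` if `p < ∞`, and `sup_{t>0} t^{-θ} K(t,x)` if
`p = ∞`. -/
def interpNorm (A : X →ₗ.[ℂ] X) (θ : ℝ) (p : ℝ≥0∞) (x : X) : ℝ≥0∞ :=
  if p = ∞ then ⨆ (t : ℝ) (_ : 0 < t), ENNReal.ofReal (t ^ (-θ) * kFunctional A t x)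
  else (∫⁻ t in Set.Ioi (0 : ℝ),
    ENNReal.ofReal (t ^ (-θ) * kFunctional A t x) ^ p.toReal * ENNReal.ofReal t⁻¹) ^ p.toReal⁻¹

end Operators

section Sequences

variable {X : Type*} [NormedAddCommGroup X]

open Classical in
/-- The scaled norm `‖(u^n)_{n=1}^N‖_{L^p(X)} = (τ ∑_{n=1}^N ‖u^n‖^p)^{1/p}`, and
`max_{1≤n≤N} ‖u^n‖` if `p = ∞`. -/
def LpNorm (p : ℝ≥0∞) (τ : ℝ) (N : ℕ) (u : ℕ → X) : ℝ≥0∞ :=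
  if p = ∞ then ⨆ n ∈ Finset.Icc 1 N, ‖u n‖ₑ
  else (ENNReal.ofReal τ * ∑ n ∈ Finset.Icc 1 N, ‖u n‖ₑ ^ p.toReal) ^ p.toReal⁻¹

/-- The scaled weak norm `‖(u^n)_{n=1}^N‖_{L^{p,∞}(X)} =
sup_{λ>0} λ |{1 ≤ n ≤ N : ‖u^n‖ > λ}|^{1/p} τ^{1/p}`, for `0 < p < ∞`. -/
def weakLpNorm (p : ℝ) (τ : ℝ) (N : ℕ) (u : ℕ → X) : ℝ≥0∞ :=
  ⨆ (l : ℝ) (_ : 0 < l), ENNReal.ofReal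
    (l * ((Finset.Icc 1 N).filter (fun n => l < ‖u n‖)).card ^ p⁻¹ * τ ^ p⁻¹)

end Sequences

/-- The backward Euler convolution quadrature weights `b_j = (-1)^j (α choose j)`, that is, the
power series coefficients of `(1 - ξ)^α`. -/
def beWeight (α : ℝ) (j : ℕ) : ℝ := (-1) ^ j * Ring.choose α j

/-- The weights are the coefficients of `(1 - ξ)^α`. -/
theorem hasSum_beWeight (α ξ : ℝ) (hξ : |ξ| < 1) :
    HasSum (fun j => beWeight α j * ξ ^ j) ((1 - ξ) ^ α) := by
  have h := (Real.one_add_rpow_hasFPowerSeriesOnBall_zero (a := α)).hasSum (y := -ξ)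
    (by simpa [Metric.mem_eball, edist_dist, ← ENNReal.ofReal_one,
      ENNReal.ofReal_lt_ofReal_iff] using hξ)
  have e : (1 - ξ) ^ α = (1 + (0 + -ξ)) ^ α := by ring_nf
  have e' : (fun j => beWeight α j * ξ ^ j) =
      fun j => binomialSeries ℝ α j (fun _ => -ξ) := by
    funext j
    simp [beWeight, binomialSeries, neg_pow ξ]
    ring
  rw [e, e']
  exact h

section Scheme

variable {X : Type*} [NormedAddCommGroup X] [NormedSpace ℂ X]

/-- The discrete fractional derivative
`(∂̄_τ^α y)^n = τ^{-α} ∑_{j=0}^n b_{n-j} y^j` of a sequence `(y^n)_{n≥0}`. -/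
def beDeriv (α τ : ℝ) (y : ℕ → X) (n : ℕ) : X :=
  ((τ ^ (-α) : ℝ) : ℂ) • ∑ j ∈ Finset.range (n + 1), ((beWeight α (n - j) : ℝ) : ℂ) • y j

/-- The discrete Caputo derivative, for `1 < α < 2`, of a sequence with initial data `v` and
`w`, as it stands on the left of the scheme: `(∂̄_τ^α (u - v - t w))^n`, with `t_n = n τ`. -/
def caputoBE (α τ : ℝ) (v w : X) (u : ℕ → X) (n : ℕ) : X :=
  beDeriv α τ (fun j => u j - v - ((j * τ : ℝ) : ℂ) • w) n

/-- `(u^n)_{n≥0}` solves the backward Euler scheme for `∂_t^α u = A u`, `u(0) = v`,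
`∂_t u(0) = w` with step size `τ`: `u^0 = v`, and `u^n ∈ D(A)` with
`∂̄_τ^α (u - v - t w)^n = A u^n` for all `n ≥ 1`. -/
structure IsBESolution (A : X →ₗ.[ℂ] X) (α τ : ℝ) (v w : X) (u : ℕ → X) : Prop where
  init : u 0 = v
  mem_domain : ∀ n, 1 ≤ n → u n ∈ A.domain
  scheme : ∀ n, 1 ≤ n → caputoBE α τ v w u n = opVal A (u n)

end Scheme

end FracBE

end

/-! Let z(ξ) = ((1 − ξ)/τ)^α be the symbol of the discrete derivative. With the zeroth term of u
replaced by 0, the scheme reads z(U − G) = AU in generating functions, where G = ξ(1 − ξ)⁻¹v + τξ(1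
− ξ)⁻²w. Hence the derivative D = z(U − G) equals zAR(z)G, and D^{n+1} is τ^{-α} times the n-th
coefficient of (1 − ξ)^{α−1}AR(z)v + τ(1 − ξ)^{α−2}AR(z)w (`IsBESolution.caputoBE_eq`).

For |ξ| < 1 the symbol lies in the sector, so P = zR(z) is bounded by M, and AR(z) = P − 1. Since P'
= −α(1 − ξ)⁻¹(P − P²), the k-th derivative of (1 − ξ)^{-γ}(P − 1), k ≤ 2, is O(|1 − ξ|^{-γ-k}). For
γ > −1 this forces coefficients of size (m + 1)^{γ−1} (`norm_taylorCoeff_le_rpow`). The exponents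
needed are γ = 1 − α and 2 − α, both above −1 because α < 2. On D(A), AR(z) = z⁻¹PA multiplies the
bound by t^α, t = (m + 1)τ. Splitting the data therefore produces K-functionals at t^α: ‖D^n‖ is at
most a constant times t_n^{-α}K(t_n^α, v) + t_n^{-(α−1)} min(K(t_n^α, w), ‖w‖)
(`IsBESolution.norm_caputoBE_le`).

The substitution s = t^α dominates the discrete L^p norm of t^{-κ}K(t^α, ·) by the interpolation
norm with θ = (κ − 1/p)/α (`LpNorm_kFunctional_le`): κ = α for v, κ = α − 1 for w. If ‖w‖ is used
instead, t^{-(α−1)} remains, which is p-integrable near 0 for p < 1/(α − 1) and weakly so at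
equality. Since Au^n = D^n, the second norm only doubles the constant. -/

noncomputable section

namespace FracBE

open scoped Nat
open Finset

/-! ### Taylor coefficients of vector-valued functions on the unit disc -/

section TaylorCoeff

variable {E : Type*} [NormedAddCommGroup E] [NormedSpace ℂ E]
  {F : Type*} [NormedAddCommGroup F] [NormedSpace ℂ F]

/-- The `n`-th Taylor coefficient of `f` at `0`. -/
def taylorCoeff (f : ℂ → E) (n : ℕ) : E := (n ! : ℂ)⁻¹ • iteratedDeriv n f 0

theorem taylorCoeff_congr {f g : ℂ → E} (h : ∀ ξ ∈ Metric.ball (0 : ℂ) 1, f ξ = g ξ) :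
    taylorCoeff f = taylorCoeff g := by
  funext n
  have : f =ᶠ[nhds 0] g := by
    filter_upwards [Metric.ball_mem_nhds (0 : ℂ) one_pos] with ξ hξ using h ξ hξ
  rw [taylorCoeff, taylorCoeff, this.iteratedDeriv_eq]

theorem taylorCoeff_const_smul {f : ℂ → E} (c : ℂ) (n : ℕ) :
    taylorCoeff (fun ξ => c • f ξ) n = c • taylorCoeff f n := by
  simp only [taylorCoeff, iteratedDeriv_fun_const_smul_field]
  rw [smul_comm]

theorem contDiffAt_of_ball {f : ℂ → E} [CompleteSpace E]
    (hf : DifferentiableOn ℂ f (Metric.ball 0 1)) {n : ℕ} : ContDiffAt ℂ n f 0 :=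
  (hf.analyticAt (Metric.ball_mem_nhds _ one_pos)).contDiffAt

theorem taylorCoeff_clm [CompleteSpace E] (L : E →L[ℂ] F) {f : ℂ → E}
    (hf : DifferentiableOn ℂ f (Metric.ball 0 1)) (n : ℕ) :
    taylorCoeff (fun ξ => L (f ξ)) n = L (taylorCoeff f n) := by
  have h := L.iteratedFDeriv_comp_left (contDiffAt_of_ball hf (n := n)) (i := n) le_rfl
  simp only [taylorCoeff, iteratedDeriv_eq_iteratedFDeriv, map_smul]
  change _ • (iteratedFDeriv ℂ n (L ∘ f) 0) _ = _
  rw [h]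
  simp

theorem taylorCoeff_add_const [CompleteSpace E] {f : ℂ → E}
    (c : E) (n : ℕ) : taylorCoeff (fun ξ => f ξ + c) n
      = taylorCoeff f n + (Pi.single 0 c : ℕ → E) n := by
  rcases n with _ | n
  · simp [taylorCoeff]
  · simp only [taylorCoeff, iteratedDeriv_succ']
    simp

theorem taylorCoeff_deriv {f f' : ℂ → E}
    (h : ∀ ξ ∈ Metric.ball (0 : ℂ) 1, HasDerivAt f (f' ξ) ξ) (n : ℕ) :
    taylorCoeff f' n = ((n : ℂ) + 1) • taylorCoeff f (n + 1) := by
  rw [← taylorCoeff_congr fun ξ hξ => (h ξ hξ).deriv, taylorCoeff, taylorCoeff,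
    iteratedDeriv_succ', smul_smul, Nat.factorial_succ]
  congr 1
  have : (n : ℂ) + 1 ≠ 0 := by exact_mod_cast n.succ_ne_zero
  push_cast
  field_simp

/-- Convolution of a scalar sequence with a vector sequence. -/
def conv (c : ℕ → ℂ) (y : ℕ → E) (n : ℕ) : E := ∑ ij ∈ antidiagonal n, c ij.1 • y ij.2

theorem taylorCoeff_smul [CompleteSpace E] {h : ℂ → ℂ} {f : ℂ → E}
    (hh : DifferentiableOn ℂ h (Metric.ball 0 1))
    (hf : DifferentiableOn ℂ f (Metric.ball 0 1)) :
    taylorCoeff (fun ξ => h ξ • f ξ) = conv (taylorCoeff h) (taylorCoeff f) := by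
  funext n
  have key := iteratedDerivWithin_smul (n := n) (Set.mem_univ (0 : ℂ)) uniqueDiffOn_univ
    (contDiffAt_of_ball hh).contDiffWithinAt (contDiffAt_of_ball hf).contDiffWithinAt
  simp only [iteratedDerivWithin_univ] at key
  rw [taylorCoeff]
  change _ • iteratedDeriv n (h • f) 0 = _
  rw [key, conv, Finset.Nat.sum_antidiagonal_eq_sum_range_succ
    (fun i j => taylorCoeff h i • taylorCoeff f j), smul_sum]
  refine sum_congr rfl fun i hi => ?_
  have hi' : i ≤ n := by simpa [Nat.lt_succ_iff] using hi
  have := Nat.choose_mul_factorial_mul_factorial hi'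
  have e : (n ! : ℂ) = n.choose i * i ! * (n - i)! := by exact_mod_cast this.symm
  have h1 : (n.choose i : ℂ) ≠ 0 := by exact_mod_cast (Nat.choose_pos hi').ne'
  have h2 : (i ! : ℂ) ≠ 0 := by exact_mod_cast i.factorial_ne_zero
  have h3 : ((n - i)! : ℂ) ≠ 0 := by exact_mod_cast (n - i).factorial_ne_zero
  simp only [taylorCoeff, smul_smul, smul_eq_mul, ← Nat.cast_smul_eq_nsmul ℂ, e]
  congr 1
  field_simp

theorem taylorCoeff_id (n : ℕ) :
    taylorCoeff (fun ξ : ℂ => ξ) n = if n = 1 then 1 else 0 := by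
  rw [taylorCoeff, iteratedDeriv_fun_id_zero]
  split_ifs with h <;> simp [h]

theorem taylorCoeff_mul_id [CompleteSpace E] {f : ℂ → E}
    (hf : DifferentiableOn ℂ f (Metric.ball 0 1)) (n : ℕ) :
    taylorCoeff (fun ξ => ξ • f ξ) (n + 1) = taylorCoeff f n := by
  rw [taylorCoeff_smul (h := fun ξ => ξ) differentiableOn_id hf, conv, Nat.antidiagonal_succ]
  simp only [taylorCoeff_id]
  rcases n with _ | n
  · simp
  · simp [Nat.antidiagonal_succ]

/-- Cauchy's estimate with the mean over the circle. The maximum would cost a power of 1/(1 − r) for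
functions singular only at ξ = 1. -/
theorem norm_taylorCoeff_le [CompleteSpace E] {f : ℂ → E}
    (hf : DifferentiableOn ℂ f (Metric.ball 0 1)) {r : ℝ} (h0 : 0 < r) (h1 : r < 1) (n : ℕ) :
    ‖taylorCoeff f n‖ ≤
      ((2 * Real.pi)⁻¹ * ∫ θ : ℝ in 0..2 * Real.pi, ‖f (circleMap 0 r θ)‖) * r⁻¹ ^ n := by
  have hf' : DifferentiableOn ℂ f (Metric.closedBall 0 r) :=
    hf.mono (Metric.closedBall_subset_ball h1)
  lift r to ℝ≥0 using h0.le
  have key := (hf'.hasFPowerSeriesOnBall (by exact_mod_cast h0)).factorial_smul 1 n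
  rw [iteratedFDeriv_apply_eq_iteratedDeriv_mul_prod, Finset.prod_const_one, one_smul] at key
  have h : taylorCoeff f n = cauchyPowerSeries f 0 r n fun _ => 1 := by
    rw [taylorCoeff, ← key, ← Nat.cast_smul_eq_nsmul ℂ, smul_smul, inv_mul_cancel₀, one_smul]
    exact_mod_cast n.factorial_ne_zero
  have h3 := (norm_cauchyPowerSeries_le f 0 r n)
  rw [abs_of_pos h0] at h3
  rw [h]
  refine le_trans (ContinuousMultilinearMap.le_opNorm _ _) ?_
  simpa using h3

end TaylorCoeff

/-! ### Circle means of negative powers of |1 − ξ| -/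

section CircleIntegral

theorem norm_one_sub_circleMap_sq (r θ : ℝ) :
    ‖1 - circleMap 0 r θ‖ ^ 2 = (1 - r) ^ 2 + 4 * r * Real.sin (θ / 2) ^ 2 := by
  have h : circleMap 0 r θ = (r * Real.cos θ : ℝ) + (r * Real.sin θ : ℝ) * Complex.I := by
    simp [circleMap, Complex.exp_mul_I]; ring
  have h2 : (1 : ℂ) - circleMap 0 r θ
      = (1 - r * Real.cos θ : ℝ) + (-(r * Real.sin θ) : ℝ) * Complex.I := by
    rw [h]; push_cast; ring
  have h3 : Real.cos θ = 1 - 2 * Real.sin (θ / 2) ^ 2 := by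
    have := Real.cos_two_mul' (θ / 2)
    have := Real.sin_sq_add_cos_sq (θ / 2)
    rw [show 2 * (θ / 2) = θ by ring] at *
    linarith
  rw [h2, Complex.sq_norm, Complex.normSq_add_mul_I]
  have := Real.sin_sq_add_cos_sq θ
  have e : (1 - r * Real.cos θ) ^ 2 + (-(r * Real.sin θ)) ^ 2
      = 1 - 2 * r * Real.cos θ + r ^ 2 * (Real.sin θ ^ 2 + Real.cos θ ^ 2) := by ring
  rw [e, this, h3]; ring

/-- Here s is the angular distance to the point 1, either θ or 2π − θ; Jordan's inequality supplies
`h` on the respective half of the circle. -/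
theorem le_norm_one_sub_circleMap {r θ : ℝ} (hr : 1 / 2 ≤ r) (hr1 : r < 1) {s : ℝ} (hs : 0 ≤ s)
    (h : s / Real.pi ≤ Real.sin (θ / 2)) :
    (1 - r + s) / 4 ≤ ‖1 - circleMap 0 r θ‖ := by
  have hpi := Real.pi_pos
  -- A rational bound for π suffices: 2(5/16)² > 1/8, and ((a + s)/4)² ≤ (a² + s²)/8 with a = 1 − r.
  have h10 : Real.pi < (16 / 5) := by have := Real.pi_lt_d2; linarith
  refine le_of_sq_le_sq ?_ (norm_nonneg _)
  rw [norm_one_sub_circleMap_sq]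
  have h1 : s / (16 / 5) ≤ Real.sin (θ / 2) :=
    le_trans (div_le_div_of_nonneg_left hs hpi h10.le) h
  have h2 : (s / (16 / 5)) ^ 2 ≤ Real.sin (θ / 2) ^ 2 := by
    exact pow_le_pow_left₀ (by positivity) h1 2
  have h3 : 2 * (s / (16 / 5)) ^ 2 ≤ 4 * r * Real.sin (θ / 2) ^ 2 := by
    nlinarith [sq_nonneg (Real.sin (θ / 2))]
  nlinarith [sq_nonneg (1 - r - s), sq_nonneg (1 - r), sq_nonneg s]

theorem intervalIntegral_rpow_neg_le {ε β a : ℝ} (hε : 0 < ε) (hβ : 1 < β) (ha : 0 ≤ a) :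
    ∫ θ in (0 : ℝ)..a, (ε + θ) ^ (-β) ≤ ε ^ (1 - β) / (β - 1) := by
  rw [intervalIntegral.integral_comp_add_left (fun x => x ^ (-β)), integral_rpow]
  · have e : -β + 1 = 1 - β := by ring
    rw [e, add_zero, show (1 - β) = -(β - 1) by ring, div_neg, ← neg_div]
    have : 0 ≤ (ε + a) ^ (-(β - 1)) := by positivity
    gcongr
    linarith
  · right
    refine ⟨by linarith, ?_⟩
    rw [Set.uIcc_of_le (by linarith)]
    simp; intro h; linarith

/-- The standard bound of the means of `|1 - ξ|^{-β}` over circles. -/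
theorem integral_norm_one_sub_circleMap_le {r β : ℝ} (hr : 1 / 2 ≤ r) (hr1 : r < 1)
    (hβ : 1 < β) :
    ∫ θ in (0 : ℝ)..2 * Real.pi, ‖1 - circleMap 0 r θ‖ ^ (-β)
      ≤ 4 ^ β * (2 / (β - 1)) * (1 - r) ^ (1 - β) := by
  have hpi := Real.pi_pos
  have hε : 0 < 1 - r := by linarith
  set f : ℝ → ℝ := fun θ => (1 - r + θ) ^ (-β) with hf
  have hfc : ContinuousOn f (Set.uIcc 0 (2 * Real.pi)) := by
    rw [Set.uIcc_of_le (by positivity)]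
    refine ContinuousOn.rpow_const (by fun_prop) fun x hx => Or.inl ?_
    have := hx.1; linarith
  have hfi : IntervalIntegrable f MeasureTheory.volume 0 (2 * Real.pi) :=
    hfc.intervalIntegrable
  have hgi : IntervalIntegrable (fun θ => f (2 * Real.pi - θ)) MeasureTheory.volume
      0 (2 * Real.pi) := by
    simpa using (hfi.comp_sub_left (2 * Real.pi)).symm
  have hpos : ∀ θ, 0 < ‖1 - circleMap 0 r θ‖ := fun θ => by
    rw [norm_pos_iff, sub_ne_zero]
    intro h
    have := norm_circleMap_zero r θ
    rw [← h, norm_one, abs_of_pos (by linarith)] at this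
    linarith
  have hi : IntervalIntegrable (fun θ => ‖1 - circleMap 0 r θ‖ ^ (-β)) MeasureTheory.volume
      0 (2 * Real.pi) := by
    refine Continuous.intervalIntegrable ?_ _ _
    refine Continuous.rpow_const ?_ fun θ => Or.inl (hpos θ).ne'
    exact (continuous_const.sub (continuous_circleMap 0 r)).norm
  have hI : ∫ θ in (0 : ℝ)..2 * Real.pi, f (2 * Real.pi - θ) = ∫ θ in (0 : ℝ)..2 * Real.pi, f θ := by
    rw [intervalIntegral.integral_comp_sub_left]; simp
  have hle := intervalIntegral_rpow_neg_le hε hβ (a := 2 * Real.pi) (by positivity)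
  -- The circle approaches 1 at both ends of [0, 2π], so the majorant is the sum of one profile and
  -- its reflection.
  have hmono : ∫ θ in (0 : ℝ)..2 * Real.pi, ‖1 - circleMap 0 r θ‖ ^ (-β)
      ≤ ∫ θ in (0 : ℝ)..2 * Real.pi, 4 ^ β * (f θ + f (2 * Real.pi - θ)) := by
    refine intervalIntegral.integral_mono_on (by positivity) hi
      ((hfi.add hgi).const_mul _) fun θ hθ => ?_
    have key : ∀ s, 0 ≤ s → s / Real.pi ≤ Real.sin (θ / 2) →
        ‖1 - circleMap 0 r θ‖ ^ (-β) ≤ 4 ^ β * f s := fun s hs h => by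
      have h1 := le_norm_one_sub_circleMap hr hr1 hs h
      have h2 : 0 < 1 - r + s := by linarith
      calc _ ≤ ((1 - r + s) / 4) ^ (-β) :=
            Real.rpow_le_rpow_of_nonpos (by positivity) h1 (by linarith)
        _ = _ := by
            rw [Real.div_rpow h2.le (by norm_num), Real.rpow_neg (by norm_num : (0:ℝ) ≤ 4)]
            field_simp; simp [hf]
    have hf0 : ∀ s, 0 ≤ s → 0 ≤ 4 ^ β * f s := fun s hs => by
      have : 0 < 1 - r + s := by linarith
      simp only [hf]; positivity
    rw [mul_add]
    rcases le_total θ Real.pi with h | h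
    · have h1 := key θ hθ.1 (by
        have := Real.mul_le_sin (x := θ / 2) (by linarith [hθ.1]) (by linarith)
        refine le_trans (le_of_eq ?_) this
        field_simp)
      have := hf0 (2 * Real.pi - θ) (by linarith [hθ.2])
      linarith
    · have h1 := key (2 * Real.pi - θ) (by linarith [hθ.2]) (by
        have := Real.mul_le_sin (x := Real.pi - θ / 2) (by linarith [hθ.2]) (by linarith)
        rw [Real.sin_pi_sub] at this
        refine le_trans (le_of_eq ?_) this
        field_simp)
      have := hf0 θ hθ.1
      linarith
  refine hmono.trans ?_
  rw [intervalIntegral.integral_const_mul, intervalIntegral.integral_add hfi hgi, hI, mul_assoc]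
  gcongr
  have : 2 / (β - 1) * (1 - r) ^ (1 - β) = 2 * ((1 - r) ^ (1 - β) / (β - 1)) := by ring
  rw [this]
  linarith

end CircleIntegral

/-! ### Coefficient decay from a singularity at ξ = 1 -/

section CoefficientDecay

variable {E : Type*} [NormedAddCommGroup E] [NormedSpace ℂ E] [CompleteSpace E]

/-- The constant in `norm_taylorCoeff_le_rpow`. -/
def coeffConst (γ : ℝ) : ℝ :=
  (2 * Real.pi)⁻¹ * (18 * 2 ^ (γ + 1) * (4 ^ (γ + 2) * (2 / (γ + 1)))) * 3

theorem coeffConst_nonneg {γ : ℝ} (hγ : -1 < γ) : 0 ≤ coeffConst γ := by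
  have : 0 < γ + 1 := by linarith
  have := Real.pi_pos
  unfold coeffConst; positivity

/-- Two derivatives raise the singularity to the exponent γ + 2 > 1, where circle means over radius
1 − 1/(m + 2) grow like m^{γ+1}; dividing by the factor of order m² from differentiation leaves
m^{γ−1}. -/
theorem norm_taylorCoeff_le_rpow {f f₁ f₂ : ℂ → E} {C γ : ℝ} (hγ : -1 < γ) (hC : 0 ≤ C)
    (h₁ : ∀ ξ ∈ Metric.ball (0 : ℂ) 1, HasDerivAt f (f₁ ξ) ξ)
    (h₂ : ∀ ξ ∈ Metric.ball (0 : ℂ) 1, HasDerivAt f₁ (f₂ ξ) ξ)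
    (b₀ : ∀ ξ ∈ Metric.ball (0 : ℂ) 1, ‖f ξ‖ ≤ C * ‖1 - ξ‖ ^ (-γ))
    (b₁ : ∀ ξ ∈ Metric.ball (0 : ℂ) 1, ‖f₁ ξ‖ ≤ C * ‖1 - ξ‖ ^ (-(γ + 1)))
    (b₂ : ∀ ξ ∈ Metric.ball (0 : ℂ) 1, ‖f₂ ξ‖ ≤ C * ‖1 - ξ‖ ^ (-(γ + 2))) (m : ℕ) :
    ‖taylorCoeff f m‖ ≤ C * coeffConst γ * (m + 1 : ℝ) ^ (γ - 1) := by
  -- The factor ξ² shifts indices so that the m-th coefficient of g'' is (m + 1)(m + 2) times that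
  -- of f, which covers m = 0 and 1 as well.
  set g : ℂ → E := fun ξ => ξ • ξ • f ξ with hg
  set g₁ : ℂ → E := fun ξ => ξ • (ξ • f₁ ξ + (1 : ℂ) • f ξ) + (1 : ℂ) • (ξ • f ξ) with hg₁
  set g₂ : ℂ → E := fun ξ => (2 : ℂ) • f ξ + (4 * ξ) • f₁ ξ + (ξ * ξ) • f₂ ξ with hg₂
  have d₁ : ∀ ξ ∈ Metric.ball (0 : ℂ) 1, HasDerivAt g (g₁ ξ) ξ := fun ξ hξ =>
    (hasDerivAt_id ξ).smul ((hasDerivAt_id ξ).smul (h₁ ξ hξ))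
  have d₂ : ∀ ξ ∈ Metric.ball (0 : ℂ) 1, HasDerivAt g₁ (g₂ ξ) ξ := fun ξ hξ => by
    have := ((hasDerivAt_id ξ).smul (((hasDerivAt_id ξ).smul (h₂ ξ hξ)).add
      ((h₁ ξ hξ).const_smul (1 : ℂ)))).add
      (((hasDerivAt_id ξ).smul (h₁ ξ hξ)).const_smul (1 : ℂ))
    refine this.congr_deriv ?_
    simp only [hg₂, Pi.add_apply, Pi.smul_apply, Pi.smul_apply', id]
    module
  have hf : DifferentiableOn ℂ f (Metric.ball 0 1) := fun ξ hξ =>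
    (h₁ ξ hξ).differentiableAt.differentiableWithinAt
  have hf₁ : DifferentiableOn ℂ f₁ (Metric.ball 0 1) := fun ξ hξ =>
    (h₂ ξ hξ).differentiableAt.differentiableWithinAt
  have hd : DifferentiableOn ℂ g₁ (Metric.ball 0 1) := fun ξ hξ =>
    (d₂ ξ hξ).differentiableAt.differentiableWithinAt
  have hf₂ : DifferentiableOn ℂ g₂ (Metric.ball 0 1) :=
    (hd.deriv Metric.isOpen_ball).congr fun ξ hξ => (d₂ ξ hξ).deriv.symm
  have e : taylorCoeff g₂ m = (((m : ℂ) + 1) * (((m + 1 : ℕ) : ℂ) + 1)) • taylorCoeff f m := by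
    rw [taylorCoeff_deriv d₂, taylorCoeff_deriv d₁, hg,
      taylorCoeff_mul_id (f := fun ξ => ξ • f ξ) (differentiableOn_id.smul hf),
      taylorCoeff_mul_id hf, smul_smul]
  have hm : (0 : ℝ) < m + 1 := by positivity
  -- Balances the two losses: r^{-m} stays below e, and 1 − r = 1/(m + 2).
  set r : ℝ := (m + 1) / (m + 2) with hr
  have hr0 : 0 < r := by positivity
  have hr1 : r < 1 := by rw [hr, div_lt_one (by positivity)]; linarith
  have hr2 : 1 / 2 ≤ r := by
    rw [hr, div_le_div_iff₀ (by norm_num) (by positivity)]; linarith [(m.cast_nonneg : (0:ℝ) ≤ m)]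
  have hrm : r⁻¹ ^ m ≤ 3 := by
    have h1 : r⁻¹ = 1 + 1 / (m + 1 : ℝ) := by rw [hr]; field_simp; ring
    have h2 : r⁻¹ ≤ Real.exp (1 / (m + 1 : ℝ)) := by
      rw [h1, add_comm]; exact Real.add_one_le_exp _
    calc r⁻¹ ^ m ≤ Real.exp (1 / (m + 1 : ℝ)) ^ m := by gcongr
      _ = Real.exp (m / (m + 1 : ℝ)) := by rw [← Real.exp_nat_mul]; congr 1; ring
      _ ≤ Real.exp 1 := by
          gcongr; rw [div_le_one hm]; linarith
      _ ≤ 3 := by linarith [Real.exp_one_lt_d9]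
  have hint : ∫ θ in (0 : ℝ)..2 * Real.pi, ‖g₂ (circleMap 0 r θ)‖
      ≤ C * 18 * (4 ^ (γ + 2) * (2 / (γ + 1)) * (1 - r) ^ (-(γ + 1))) := by
    have hc : ∀ θ, circleMap 0 r θ ∈ Metric.ball (0 : ℂ) 1 := fun θ => by
      simp [abs_of_pos hr0, hr1]
    have hpos : ∀ ξ ∈ Metric.ball (0 : ℂ) 1, 0 < ‖1 - ξ‖ := fun ξ hξ => by
      rw [norm_pos_iff, sub_ne_zero]
      rintro rfl
      simp at hξ
    -- As |1 − ξ| ≤ 2, the lower order terms cost factors 4 and 2, for a total of 2·4 + 4·2 + 1 =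
    -- 17.
    have hb : ∀ ξ ∈ Metric.ball (0 : ℂ) 1, ‖g₂ ξ‖ ≤ C * 18 * ‖1 - ξ‖ ^ (-(γ + 2)) := fun ξ hξ => by
      have hp := hpos ξ hξ
      have hξ1 : ‖ξ‖ ≤ 1 := by simpa using (mem_ball_zero_iff.1 hξ).le
      have h2 : ‖1 - ξ‖ ≤ 2 := (norm_sub_le _ _).trans (by simp; linarith)
      have e1 : ‖1 - ξ‖ ^ (-γ) = ‖1 - ξ‖ ^ 2 * ‖1 - ξ‖ ^ (-(γ + 2)) := by
        rw [← Real.rpow_natCast, ← Real.rpow_add hp]; congr 1; push_cast; ring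
      have e2 : ‖1 - ξ‖ ^ (-(γ + 1)) = ‖1 - ξ‖ * ‖1 - ξ‖ ^ (-(γ + 2)) := by
        nth_rw 2 [← Real.rpow_one ‖1 - ξ‖]; rw [← Real.rpow_add hp]; congr 1; ring
      have c0 := b₀ ξ hξ
      have c1 := b₁ ξ hξ
      have c2 := b₂ ξ hξ
      rw [e1] at c0
      rw [e2] at c1
      set z := C * ‖1 - ξ‖ ^ (-(γ + 2)) with hz
      have hz0 : 0 ≤ z := by positivity
      have c0' : ‖f ξ‖ ≤ 4 * z := c0.trans (by
        have : ‖1 - ξ‖ ^ 2 ≤ 4 := by nlinarith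
        calc _ = ‖1 - ξ‖ ^ 2 * z := by rw [hz]; ring
          _ ≤ _ := by gcongr)
      have c1' : ‖f₁ ξ‖ ≤ 2 * z := c1.trans (by
        calc _ = ‖1 - ξ‖ * z := by rw [hz]; ring
          _ ≤ _ := by gcongr)
      calc ‖g₂ ξ‖ ≤ 2 * ‖f ξ‖ + 4 * ‖ξ‖ * ‖f₁ ξ‖ + ‖ξ‖ * ‖ξ‖ * ‖f₂ ξ‖ := by
            refine (norm_add₃_le).trans (le_of_eq ?_)
            simp [norm_smul]
        _ ≤ 2 * (4 * z) + 4 * 1 * (2 * z) + 1 * 1 * z := by gcongr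
        _ ≤ C * 18 * ‖1 - ξ‖ ^ (-(γ + 2)) := by
            have : C * 18 * ‖1 - ξ‖ ^ (-(γ + 2)) = 18 * z := by rw [hz]; ring
            rw [this]; linarith
    have hcont : Continuous fun θ : ℝ => ‖1 - circleMap 0 r θ‖ ^ (-(γ + 2)) := by
      refine Continuous.rpow_const ?_ fun θ => Or.inl (hpos _ (hc θ)).ne'
      exact (continuous_const.sub (continuous_circleMap 0 r)).norm
    have hg₂c : Continuous fun θ : ℝ => ‖g₂ (circleMap 0 r θ)‖ := by
      refine Continuous.norm ?_
      exact hf₂.continuousOn.comp_continuous (continuous_circleMap 0 r) hc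
    calc _ ≤ ∫ θ in (0 : ℝ)..2 * Real.pi, C * 18 * ‖1 - circleMap 0 r θ‖ ^ (-(γ + 2)) := by
          refine intervalIntegral.integral_mono_on (by positivity)
            (hg₂c.intervalIntegrable _ _) ((hcont.const_mul _).intervalIntegrable _ _)
            fun θ _ => hb _ (hc θ)
      _ ≤ _ := by
          rw [intervalIntegral.integral_const_mul]
          have := integral_norm_one_sub_circleMap_le hr2 hr1 (β := γ + 2) (by linarith)
          rw [show γ + 2 - 1 = γ + 1 by ring, show 1 - (γ + 2) = -(γ + 1) by ring] at this
          gcongr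
  have h1r : (1 - r) ^ (-(γ + 1)) ≤ 2 ^ (γ + 1) * (m + 1 : ℝ) ^ (γ + 1) := by
    have : 1 - r = (m + 2 : ℝ)⁻¹ := by rw [hr]; field_simp; ring
    rw [this, Real.inv_rpow (by positivity), Real.rpow_neg (by positivity), inv_inv,
      ← Real.mul_rpow (by norm_num) hm.le]
    exact Real.rpow_le_rpow (by positivity) (by linarith [(m.cast_nonneg : (0:ℝ) ≤ m)])
      (by linarith)
  have hγ1 : 0 < γ + 1 := by linarith
  have hpi := Real.pi_pos
  have h3 : ‖taylorCoeff g₂ m‖ ≤ C * coeffConst γ * (m + 1 : ℝ) ^ (γ + 1) := by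
    refine (norm_taylorCoeff_le hf₂ hr0 hr1 m).trans ?_
    calc _ ≤ ((2 * Real.pi)⁻¹ * (C * 18 * (4 ^ (γ + 2) * (2 / (γ + 1)) *
            (2 ^ (γ + 1) * (m + 1 : ℝ) ^ (γ + 1))))) * 3 := by
          gcongr
          exact hint.trans (by gcongr)
      _ = _ := by rw [coeffConst]; ring
  rw [e, norm_smul, norm_mul] at h3
  have n1 : ‖(m : ℂ) + 1‖ = m + 1 := by
    rw [show (m : ℂ) + 1 = ((m + 1 : ℝ) : ℂ) by push_cast; rfl, Complex.norm_real,
      Real.norm_of_nonneg hm.le]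
  have n2 : (m : ℝ) + 1 ≤ ‖((m + 1 : ℕ) : ℂ) + 1‖ := by
    rw [show ((m + 1 : ℕ) : ℂ) + 1 = ((m + 2 : ℝ) : ℂ) by push_cast; ring, Complex.norm_real,
      Real.norm_of_nonneg (by positivity)]
    linarith
  rw [n1] at h3
  have e3 : (m + 1 : ℝ) ^ (γ + 1) = ((m + 1) * (m + 1)) * (m + 1 : ℝ) ^ (γ - 1) := by
    rw [show γ + 1 = 2 + (γ - 1) by ring, Real.rpow_add hm, Real.rpow_two, sq]
  rw [e3] at h3
  refine le_of_mul_le_mul_left ?_ (mul_pos hm hm)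
  calc _ ≤ ((m : ℝ) + 1) * ‖((m + 1 : ℕ) : ℂ) + 1‖ * ‖taylorCoeff f m‖ := by gcongr
    _ ≤ _ := h3
    _ = _ := by ring

end CoefficientDecay

/-! ### The resolvent identity and holomorphy of the resolvent -/

section Resolvent

variable {X : Type*} [NormedAddCommGroup X] [NormedSpace ℂ X]

open Classical in
/-- The resolvent `R(z; A)`, extended by `0` off the resolvent set. -/
def resolventFun (A : X →ₗ.[ℂ] X) (z : ℂ) : X →L[ℂ] X :=
  if h : ∃ R : X →L[ℂ] X, IsResolvent A z R then h.choose else 0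

theorem IsSectorial.isResolvent {A : X →ₗ.[ℂ] X} {θ : ℝ} (hA : IsSectorial A θ) {z : ℂ}
    (hz : z ∈ sector θ) : IsResolvent A z (resolventFun A z) := by
  have h : ∃ R : X →L[ℂ] X, IsResolvent A z R := by
    by_contra h
    exact hA.spectrum_subset (show z ∈ spectrum A from h) hz
  rw [resolventFun, dif_pos h]
  exact h.choose_spec

/-- Apply R to (z − A)Sx = (z − w)Sx + x. -/
theorem IsResolvent.sub_eq {A : X →ₗ.[ℂ] X} {z w : ℂ} {R S : X →L[ℂ] X}
    (hR : IsResolvent A z R) (hS : IsResolvent A w S) : S - R = (z - w) • (R * S) := by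
  ext x
  have h1 := hR.left_inv ⟨S x, hS.mem_domain x⟩
  have h2 := hS.right_inv x
  have h3 : z • S x - A ⟨S x, hS.mem_domain x⟩ = (z - w) • S x + x := by
    rw [← sub_eq_zero] at h2 ⊢
    rw [← h2]; module
  simp only [h3, map_add, map_smul] at h1
  exact sub_eq_iff_eq_add.2 h1.symm

theorem eventually_mem_sector {θ : ℝ} (hθ : θ ≤ Real.pi) {z : ℂ} (hz : z ∈ sector θ) :
    ∀ᶠ w in nhds z, w ∈ sector θ := by
  have hs : z ∈ Complex.slitPlane := by
    rw [Complex.mem_slitPlane_iff_arg]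
    refine ⟨fun h => ?_, hz.1⟩
    have := hz.2
    rw [h, abs_of_pos Real.pi_pos] at this
    linarith
  filter_upwards [isOpen_ne.mem_nhds hz.1,
    (Complex.continuousAt_arg hs).abs.eventually (gt_mem_nhds hz.2)] with w h1 h2 using ⟨h1, h2⟩

variable {A : X →ₗ.[ℂ] X} {θ M : ℝ}

theorem ResolventBound.norm_le (hA : IsSectorial A θ) (hM : ResolventBound A θ M) {z : ℂ}
    (hz : z ∈ sector θ) : ‖resolventFun A z‖ ≤ M / ‖z‖ := by
  have := hM z hz _ (hA.isResolvent hz)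
  rw [norm_smul] at this
  rw [le_div_iff₀ (norm_pos_iff.2 hz.1)]
  linarith

theorem tendsto_resolventFun (hθ : θ ≤ Real.pi) (hA : IsSectorial A θ)
    (hM : ResolventBound A θ M) {z : ℂ} (hz : z ∈ sector θ) :
    Filter.Tendsto (resolventFun A) (nhds z) (nhds (resolventFun A z)) := by
  rw [tendsto_iff_norm_sub_tendsto_zero]
  have hlim : Filter.Tendsto (fun w => ‖z - w‖ * (‖resolventFun A z‖ * (M / ‖w‖)))
      (nhds z) (nhds 0) := by
    have : ContinuousAt (fun w => ‖z - w‖ * (‖resolventFun A z‖ * (M / ‖w‖))) z := by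
      have := norm_ne_zero_iff.2 hz.1
      fun_prop (disch := assumption)
    simpa [ContinuousAt] using this
  refine squeeze_zero' (Filter.Eventually.of_forall fun _ => norm_nonneg _) ?_ hlim
  filter_upwards [eventually_mem_sector hθ hz] with w hw
  rw [(hA.isResolvent hz).sub_eq (hA.isResolvent hw), norm_smul]
  gcongr
  exact (norm_mul_le _ _).trans (by gcongr; exact hM.norm_le hA hw)

/-- By the resolvent identity the difference quotient is exactly −R(z)R(w), so continuity of the
resolvent is enough. -/
theorem hasDerivAt_resolventFun (hθ : θ ≤ Real.pi) (hA : IsSectorial A θ)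
    (hM : ResolventBound A θ M) {z : ℂ} (hz : z ∈ sector θ) :
    HasDerivAt (resolventFun A) (-(resolventFun A z * resolventFun A z)) z := by
  rw [hasDerivAt_iff_tendsto_slope]
  have h := ((tendsto_resolventFun hθ hA hM hz).const_mul (resolventFun A z)).neg
  refine (h.mono_left nhdsWithin_le_nhds).congr' ?_
  filter_upwards [nhdsWithin_le_nhds (eventually_mem_sector hθ hz), self_mem_nhdsWithin] with w hw hne
  rw [slope, vsub_eq_sub, (hA.isResolvent hz).sub_eq (hA.isResolvent hw), smul_smul]
  have : w - z ≠ 0 := sub_ne_zero.2 hne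
  rw [show (w - z)⁻¹ * (z - w) = -1 by field_simp; ring, neg_one_smul]

end Resolvent

/-! ### The symbol and the singular functions (1 − ξ)^{-γ}Q -/

section Symbol

/-- The symbol `((1 - ξ) / τ)^α` of the discrete fractional derivative. -/
def beSymbol (α τ : ℝ) (ξ : ℂ) : ℂ := ((τ ^ (-α) : ℝ) : ℂ) * (1 - ξ) ^ (α : ℂ)

theorem one_sub_re_pos {ξ : ℂ} (hξ : ξ ∈ Metric.ball (0 : ℂ) 1) : 0 < (1 - ξ).re := by
  have := (Complex.re_le_norm ξ).trans_lt (mem_ball_zero_iff.1 hξ)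
  simpa using this

theorem one_sub_ne_zero {ξ : ℂ} (hξ : ξ ∈ Metric.ball (0 : ℂ) 1) : 1 - ξ ≠ 0 := fun h => by
  have := one_sub_re_pos hξ
  rw [h] at this
  simp at this

/-- The power α multiplies the argument of 1 − ξ, which is below π/2 in modulus, by α; since α < 2
the product stays in (−π, π) and is the principal argument. -/
theorem beSymbol_mem_sector {α τ : ℝ} (hα0 : 0 < α) (hα2 : α < 2) (hτ : 0 < τ) {ξ : ℂ}
    (hξ : ξ ∈ Metric.ball (0 : ℂ) 1) : beSymbol α τ ξ ∈ sector (α * Real.pi / 2) := by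
  have hpi := Real.pi_pos
  have hne := one_sub_ne_zero hξ
  have hτ' : 0 < τ ^ (-α) := Real.rpow_pos_of_pos hτ _
  have harg := Complex.abs_arg_lt_pi_div_two_iff.2 (Or.inl (one_sub_re_pos hξ))
  have hlt : |α * (1 - ξ).arg| < α * Real.pi / 2 := by
    rw [abs_mul, abs_of_pos hα0, mul_div_assoc]
    gcongr
  have hlt2 := abs_lt.1 (hlt.trans (by nlinarith : α * Real.pi / 2 < Real.pi))
  refine ⟨mul_ne_zero (by exact_mod_cast hτ'.ne') ?_, ?_⟩
  · rw [Ne, Complex.cpow_eq_zero_iff]; tauto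
  · rw [beSymbol, Complex.arg_real_mul _ hτ', Complex.cpow_def_of_ne_zero hne, ← Complex.log_im]
    have him : (Complex.log (1 - ξ) * α).im = α * (1 - ξ).arg := by
      rw [Complex.im_mul_ofReal, Complex.log_im, mul_comm]
    rw [Complex.log_exp (by rw [him]; exact hlt2.1) (by rw [him]; exact hlt2.2.le), him]
    exact hlt

/-- The function `(1 - ξ)^{-γ}`. -/
def oneSubPow (γ : ℝ) (ξ : ℂ) : ℂ := (1 - ξ) ^ ((-γ : ℝ) : ℂ)

theorem oneSubPow_add {γ δ : ℝ} {ξ : ℂ} (hξ : ξ ∈ Metric.ball (0 : ℂ) 1) :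
    oneSubPow (γ + δ) ξ = oneSubPow γ ξ * oneSubPow δ ξ := by
  rw [oneSubPow, oneSubPow, oneSubPow, ← Complex.cpow_add _ _ (one_sub_ne_zero hξ)]
  congr 1; push_cast; ring

theorem oneSubPow_one (ξ : ℂ) : oneSubPow 1 ξ = (1 - ξ)⁻¹ := by
  rw [oneSubPow, Complex.ofReal_neg, Complex.ofReal_one, Complex.cpow_neg_one]

theorem norm_oneSubPow (γ : ℝ) (ξ : ℂ) : ‖oneSubPow γ ξ‖ = ‖1 - ξ‖ ^ (-γ) :=
  Complex.norm_cpow_real _ _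

theorem hasDerivAt_oneSubPow (γ : ℝ) {ξ : ℂ} (hξ : ξ ∈ Metric.ball (0 : ℂ) 1) :
    HasDerivAt (oneSubPow γ) (γ * oneSubPow (γ + 1) ξ) ξ := by
  have h := ((hasDerivAt_id ξ).const_sub (1 : ℂ)).cpow_const (c := ((-γ : ℝ) : ℂ))
    (Or.inl (one_sub_re_pos hξ))
  refine h.congr_deriv ?_
  simp only [id, oneSubPow]
  rw [show (((-γ : ℝ) : ℂ) - 1) = ((-(γ + 1) : ℝ) : ℂ) by push_cast; ring]
  push_cast; ring

theorem beSymbol_eq (α τ : ℝ) (ξ : ℂ) :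
    beSymbol α τ ξ = ((τ ^ (-α) : ℝ) : ℂ) * oneSubPow (-α) ξ := by
  simp [beSymbol, oneSubPow]

theorem hasDerivAt_beSymbol (α τ : ℝ) {ξ : ℂ} (hξ : ξ ∈ Metric.ball (0 : ℂ) 1) :
    HasDerivAt (beSymbol α τ) (-α * (1 - ξ)⁻¹ * beSymbol α τ ξ) ξ := by
  have h := (hasDerivAt_oneSubPow (-α) hξ).const_mul ((τ ^ (-α) : ℝ) : ℂ)
  have e : beSymbol α τ = fun ξ => ((τ ^ (-α) : ℝ) : ℂ) * oneSubPow (-α) ξ :=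
    funext (beSymbol_eq α τ)
  rw [e]
  refine h.congr_deriv ?_
  rw [oneSubPow_add hξ, oneSubPow_one]
  push_cast; ring

section Algebra

variable {𝔸 : Type*} [NormedAddCommGroup 𝔸] [NormedSpace ℂ 𝔸]

/-- Differentiation keeps the shape (1 − ξ)^{-γ}Q and only raises γ by one, provided Q' is (1 − ξ)⁻¹
times a bounded function. -/
theorem hasDerivAt_oneSubPow_smul (γ : ℝ) {Q T : ℂ → 𝔸} {ξ : ℂ}
    (hξ : ξ ∈ Metric.ball (0 : ℂ) 1) (hQ : HasDerivAt Q ((1 - ξ)⁻¹ • T ξ) ξ) :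
    HasDerivAt (fun ξ => oneSubPow γ ξ • Q ξ)
      (oneSubPow (γ + 1) ξ • ((γ : ℂ) • Q ξ + T ξ)) ξ := by
  refine ((hasDerivAt_oneSubPow γ hξ).smul hQ).congr_deriv ?_
  rw [oneSubPow_add hξ, oneSubPow_one]
  module

end Algebra

/-- The constant in `norm_taylorCoeff_oneSubPow_smul_le`. -/
def symbolConst (γ B : ℝ) : ℝ := 34 * (|γ| + 1) ^ 2 * B ^ 3 * coeffConst γ

theorem symbolConst_nonneg {γ B : ℝ} (hγ : -1 < γ) (hB : 0 ≤ B) : 0 ≤ symbolConst γ B := by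
  have := coeffConst_nonneg hγ
  unfold symbolConst; positivity

/-- The Riccati equation for P makes (1 − ξ)P' a polynomial in P, so a bound of P controls both
derivatives. Q is kept apart from P, sharing only its derivative, to allow Q = P and Q = P − 1. -/
theorem norm_taylorCoeff_oneSubPow_smul_le {𝔸 : Type*} [NormedRing 𝔸] [NormedAlgebra ℂ 𝔸]
    [CompleteSpace 𝔸] {α γ B : ℝ} (hα0 : 0 < α) (hα2 : α < 2) (hγ : -1 < γ) (hB : 1 ≤ B)
    {P Q : ℂ → 𝔸}
    (hP : ∀ ξ ∈ Metric.ball (0 : ℂ) 1,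
      HasDerivAt P ((1 - ξ)⁻¹ • (-α : ℂ) • (P ξ - P ξ * P ξ)) ξ)
    (hQ : ∀ ξ ∈ Metric.ball (0 : ℂ) 1,
      HasDerivAt Q ((1 - ξ)⁻¹ • (-α : ℂ) • (P ξ - P ξ * P ξ)) ξ)
    (hPB : ∀ ξ ∈ Metric.ball (0 : ℂ) 1, ‖P ξ‖ ≤ B)
    (hQB : ∀ ξ ∈ Metric.ball (0 : ℂ) 1, ‖Q ξ‖ ≤ 2 * B) (m : ℕ) :
    ‖taylorCoeff (fun ξ => oneSubPow γ ξ • Q ξ) m‖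
      ≤ symbolConst γ B * (m + 1 : ℝ) ^ (γ - 1) := by
  set T₀ : ℂ → 𝔸 := fun ξ => (-α : ℂ) • (P ξ - P ξ * P ξ) with hT₀
  set T₁ : ℂ → 𝔸 := fun ξ => (-α : ℂ) • (T₀ ξ - (T₀ ξ * P ξ + P ξ * T₀ ξ)) with hT₁
  have dT₀ : ∀ ξ ∈ Metric.ball (0 : ℂ) 1, HasDerivAt T₀ ((1 - ξ)⁻¹ • T₁ ξ) ξ := fun ξ hξ => by
    have h := ((hP ξ hξ).sub ((hP ξ hξ).mul (hP ξ hξ))).const_smul (-α : ℂ)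
    refine h.congr_deriv ?_
    simp only [hT₁, hT₀, smul_mul_assoc, mul_smul_comm]
    module
  set U : ℂ → 𝔸 := fun ξ => (γ : ℂ) • Q ξ + T₀ ξ with hU
  set V : ℂ → 𝔸 := fun ξ => (γ : ℂ) • T₀ ξ + T₁ ξ with hV
  have dU : ∀ ξ ∈ Metric.ball (0 : ℂ) 1, HasDerivAt U ((1 - ξ)⁻¹ • V ξ) ξ := fun ξ hξ => by
    refine (((hQ ξ hξ).const_smul (γ : ℂ)).add (dT₀ ξ hξ)).congr_deriv ?_
    simp only [hV]
    module
  have hα : ‖(-α : ℂ)‖ ≤ 2 := by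
    rw [norm_neg, Complex.norm_real, Real.norm_of_nonneg hα0.le]; exact hα2.le
  have hγn : ‖(γ : ℂ)‖ = |γ| := Complex.norm_real γ
  have hγn1 : ‖((γ + 1 : ℝ) : ℂ)‖ ≤ |γ| + 1 := by
    rw [Complex.norm_real]
    exact (norm_add_le _ _).trans (by simp)
  set G := |γ| + 1 with hG
  have hG1 : 1 ≤ G := by linarith [abs_nonneg γ]
  have hγG : |γ| ≤ G := by linarith
  have hB2 : B ≤ B ^ 2 := by nlinarith
  have hB3 : B ^ 2 ≤ B ^ 3 := by nlinarith [sq_nonneg B]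
  have hGG : G ≤ G ^ 2 := by nlinarith
  have nT₀ : ∀ ξ ∈ Metric.ball (0 : ℂ) 1, ‖T₀ ξ‖ ≤ 4 * B ^ 2 := fun ξ hξ => by
    have h1 := hPB ξ hξ
    calc _ ≤ ‖(-α : ℂ)‖ * ‖P ξ - P ξ * P ξ‖ := norm_smul_le _ _
      _ ≤ 2 * (B + B * B) := by
        gcongr
        exact (norm_sub_le _ _).trans (by gcongr; exact (norm_mul_le _ _).trans (by gcongr))
      _ ≤ _ := by nlinarith
  have nT₁ : ∀ ξ ∈ Metric.ball (0 : ℂ) 1, ‖T₁ ξ‖ ≤ 24 * B ^ 3 := fun ξ hξ => by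
    have h1 := hPB ξ hξ
    have h2 := nT₀ ξ hξ
    calc _ ≤ ‖(-α : ℂ)‖ * ‖T₀ ξ - (T₀ ξ * P ξ + P ξ * T₀ ξ)‖ := norm_smul_le _ _
      _ ≤ 2 * (4 * B ^ 2 + (4 * B ^ 2 * B + B * (4 * B ^ 2))) := by
        gcongr
        refine (norm_sub_le _ _).trans ?_
        gcongr
        refine (norm_add_le _ _).trans ?_
        gcongr
        · exact (norm_mul_le _ _).trans (by gcongr)
        · exact (norm_mul_le _ _).trans (by gcongr)
      _ ≤ _ := by nlinarith
  have nU : ∀ ξ ∈ Metric.ball (0 : ℂ) 1, ‖U ξ‖ ≤ 6 * G * B ^ 3 := fun ξ hξ => by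
    have h1 := hQB ξ hξ
    have h2 := nT₀ ξ hξ
    calc _ ≤ |γ| * ‖Q ξ‖ + ‖T₀ ξ‖ := by
          refine (norm_add_le _ _).trans (le_of_eq ?_)
          rw [norm_smul, hγn]
      _ ≤ G * (2 * B ^ 3) + G * (4 * B ^ 3) := by
          gcongr
          · linarith
          · calc _ ≤ 1 * (4 * B ^ 3) := by linarith
              _ ≤ _ := by gcongr
      _ = _ := by ring
  have nV : ∀ ξ ∈ Metric.ball (0 : ℂ) 1, ‖V ξ‖ ≤ 28 * G ^ 2 * B ^ 3 := fun ξ hξ => by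
    have h1 := nT₁ ξ hξ
    have h2 := nT₀ ξ hξ
    calc _ ≤ |γ| * ‖T₀ ξ‖ + ‖T₁ ξ‖ := by
          refine (norm_add_le _ _).trans (le_of_eq ?_)
          rw [norm_smul, hγn]
      _ ≤ G ^ 2 * (4 * B ^ 3) + G ^ 2 * (24 * B ^ 3) := by
          gcongr
          · exact hγG.trans hGG
          · linarith
          · calc _ ≤ 1 * (24 * B ^ 3) := by linarith
              _ ≤ _ := by gcongr; linarith
      _ = _ := by ring
  have hBp : 0 ≤ B ^ 3 := by positivity
  -- The constant 34 = 6 + 28 comes from the second derivative, through the bounds of U and V.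
  have key := norm_taylorCoeff_le_rpow (f := fun ξ => oneSubPow γ ξ • Q ξ)
    (f₁ := fun ξ => oneSubPow (γ + 1) ξ • U ξ)
    (f₂ := fun ξ => oneSubPow (γ + 1 + 1) ξ • (((γ + 1 : ℝ) : ℂ) • U ξ + V ξ))
    (C := 34 * G ^ 2 * B ^ 3) hγ (by positivity)
    (fun ξ hξ => hasDerivAt_oneSubPow_smul γ hξ (hQ ξ hξ))
    (fun ξ hξ => hasDerivAt_oneSubPow_smul (γ + 1) hξ (dU ξ hξ))
    (fun ξ hξ => by
      rw [norm_smul, norm_oneSubPow, mul_comm]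
      gcongr
      refine (hQB ξ hξ).trans ?_
      calc _ ≤ 34 * 1 * B ^ 3 := by linarith
        _ ≤ _ := by gcongr; linarith)
    (fun ξ hξ => by
      rw [norm_smul, norm_oneSubPow, mul_comm]
      gcongr
      refine (nU ξ hξ).trans ?_
      gcongr
      · norm_num)
    (fun ξ hξ => by
      rw [norm_smul, norm_oneSubPow, mul_comm, show γ + 1 + 1 = γ + 2 by ring]
      gcongr
      calc _ ≤ ‖((γ + 1 : ℝ) : ℂ)‖ * ‖U ξ‖ + ‖V ξ‖ := by
            refine (norm_add_le _ _).trans (le_of_eq ?_)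
            rw [norm_smul]
        _ ≤ G * (6 * G * B ^ 3) + 28 * G ^ 2 * B ^ 3 := by
            gcongr
            · exact nU ξ hξ
            · exact nV ξ hξ
        _ = _ := by ring) m
  exact key

end Symbol

/-! ### Convolution of scalar, operator and vector sequences -/

section Convolution

variable {E : Type*} [NormedAddCommGroup E] [NormedSpace ℂ E]

theorem sum_antidiagonal_assoc {V : Type*} [AddCommMonoid V] (f : ℕ → ℕ → ℕ → V) (n : ℕ) :
    ∑ ij ∈ antidiagonal n, ∑ kl ∈ antidiagonal ij.2, f ij.1 kl.1 kl.2
      = ∑ ij ∈ antidiagonal n, ∑ kl ∈ antidiagonal ij.1, f kl.1 kl.2 ij.2 := by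
  simp only [Finset.sum_sigma']
  apply Finset.sum_nbij' (fun ⟨⟨i, _j⟩, ⟨k, l⟩⟩ ↦ ⟨(i + k, l), (i, k)⟩)
    (fun ⟨⟨_i, j⟩, ⟨k, l⟩⟩ ↦ ⟨(k, l + j), (l, j)⟩) <;>
    simp +contextual [add_assoc]
  rintro ⟨⟨i, j⟩, ⟨k, l⟩⟩ h1 h2
  simp only at h1 h2 ⊢
  omega

/-- Convolution of an operator sequence with a vector sequence. -/
def opConv (s : ℕ → E →L[ℂ] E) (y : ℕ → E) (n : ℕ) : E := ∑ ij ∈ antidiagonal n, s ij.1 (y ij.2)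

theorem conv_opConv (c : ℕ → ℂ) (s : ℕ → E →L[ℂ] E) (y : ℕ → E) :
    conv c (opConv s y) = opConv (conv c s) y := by
  funext n
  simp only [conv, opConv, smul_sum, _root_.sum_apply, _root_.smul_apply]
  exact sum_antidiagonal_assoc (fun i k l => c i • s k (y l)) n

theorem opConv_conv (c : ℕ → ℂ) (s : ℕ → E →L[ℂ] E) (y : ℕ → E) :
    opConv s (conv c y) = conv c (opConv s y) := by
  funext n
  simp only [conv, opConv, smul_sum, map_sum, map_smul]
  rw [sum_antidiagonal_assoc (fun i k l => c k • s i (y l)),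
    sum_antidiagonal_assoc (fun i k l => c i • s k (y l))]
  refine sum_congr rfl fun ij _ => ?_
  exact Finset.sum_nbij' Prod.swap Prod.swap (by simp [add_comm]) (by simp [add_comm])
    (by simp) (by simp) (by simp)

theorem opConv_sub (s : ℕ → E →L[ℂ] E) (y z : ℕ → E) :
    opConv s (y - z) = opConv s y - opConv s z := by
  funext n; simp [opConv]

theorem opConv_add (s : ℕ → E →L[ℂ] E) (y z : ℕ → E) :
    opConv s (y + z) = opConv s y + opConv s z := by
  funext n; simp [opConv, sum_add_distrib]

/-- The sequence has generating function ξx. This is the source of the shift from n + 1 to n in the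
solution formula. -/
theorem opConv_single_one (s : ℕ → E →L[ℂ] E) (x : E) (n : ℕ) :
    opConv s (Pi.single 1 x) (n + 1) = s n x := by
  rw [opConv, Nat.antidiagonal_succ']
  rcases n with _ | n
  · simp
  · simp [Nat.antidiagonal_succ']

theorem opConv_add_single_zero (s : ℕ → E →L[ℂ] E) (y : ℕ → E) :
    opConv (s + Pi.single 0 1) y = opConv s y + y := by
  funext n
  simp only [opConv, Pi.add_apply, _root_.add_apply, sum_add_distrib]
  congr 1
  rcases n with _ | n
  · simp
  · simp [Nat.antidiagonal_succ]

theorem taylorCoeff_one_sub : taylorCoeff (fun ξ : ℂ => 1 - ξ)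
    = Pi.single 0 1 - Pi.single 1 1 := by
  funext n
  have h : (fun ξ : ℂ => 1 - ξ) = fun ξ : ℂ => (-1 : ℂ) • ξ + 1 := by funext ξ; simp; ring
  rw [h, taylorCoeff_add_const, taylorCoeff_const_smul, taylorCoeff_id]
  rcases n with _ | _ | n <;> simp

theorem conv_one_sub_zero (y : ℕ → E) : conv (taylorCoeff fun ξ : ℂ => 1 - ξ) y 0 = y 0 := by
  simp [conv, taylorCoeff_one_sub]

theorem conv_one_sub_succ (y : ℕ → E) (n : ℕ) :
    conv (taylorCoeff fun ξ : ℂ => 1 - ξ) y (n + 1) = y (n + 1) - y n := by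
  rw [conv, taylorCoeff_one_sub]
  rcases n with _ | n
  · simp [Nat.antidiagonal_succ, sub_eq_add_neg]
  · simp [Nat.antidiagonal_succ, sub_eq_add_neg]

end Convolution

theorem taylorCoeff_beSymbol (α τ : ℝ) (n : ℕ) :
    taylorCoeff (beSymbol α τ) n = ((τ ^ (-α) : ℝ) : ℂ) * (beWeight α n : ℝ) := by
  have h := (Complex.one_add_cpow_hasFPowerSeriesOnBall_zero (a := (α : ℂ))).factorial_smul 1 n
  rw [iteratedFDeriv_apply_eq_iteratedDeriv_mul_prod, Finset.prod_const_one, one_smul] at h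
  have h2 := iteratedDeriv_comp_neg n (fun x : ℂ => (1 + x) ^ (α : ℂ)) 0
  rw [neg_zero, ← h] at h2
  have e : beSymbol α τ = fun ξ => ((τ ^ (-α) : ℝ) : ℂ) • (1 + -ξ) ^ (α : ℂ) := by
    funext ξ; rw [beSymbol, sub_eq_add_neg, smul_eq_mul]
  have hn : (n ! : ℂ) ≠ 0 := by exact_mod_cast n.factorial_ne_zero
  rw [e, taylorCoeff_const_smul, taylorCoeff, h2, beWeight]
  simp only [binomialSeries_apply, List.ofFn_const, List.prod_replicate, one_pow, smul_eq_mul,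
    mul_one, nsmul_eq_mul]
  push_cast
  field_simp

/-! ### Solving the scheme by generating functions -/

section Scheme

variable {X : Type*} [NormedAddCommGroup X] [NormedSpace ℂ X]

theorem beDeriv_eq_conv (α τ : ℝ) (y : ℕ → X) :
    beDeriv α τ y = conv (taylorCoeff (beSymbol α τ)) y := by
  funext n
  rw [beDeriv, conv, ← Finset.Nat.sum_antidiagonal_eq_sum_range_succ
    (fun j i => ((beWeight α i : ℝ) : ℂ) • y j), ← Finset.Nat.sum_antidiagonal_swap, smul_sum]
  refine sum_congr rfl fun ij _ => ?_
  rw [taylorCoeff_beSymbol, mul_smul]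
  rfl

/-- The function `ξ ↦ R(((1 - ξ) / τ)^α; A)`. -/
def resolventSymbol (A : X →ₗ.[ℂ] X) (α τ : ℝ) (ξ : ℂ) : X →L[ℂ] X :=
  resolventFun A (beSymbol α τ ξ)

/-- The function `ξ ↦ z R(z; A)`, `z = ((1 - ξ) / τ)^α`. -/
def smulResolventSymbol (A : X →ₗ.[ℂ] X) (α τ : ℝ) (ξ : ℂ) : X →L[ℂ] X :=
  beSymbol α τ ξ • resolventSymbol A α τ ξ

variable {A : X →ₗ.[ℂ] X} {α τ M : ℝ}

theorem hasDerivAt_resolventSymbol (hα1 : 1 < α) (hα2 : α < 2) (hτ : 0 < τ)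
    (hA : IsSectorial A (α * Real.pi / 2)) (hM : ResolventBound A (α * Real.pi / 2) M)
    {ξ : ℂ} (hξ : ξ ∈ Metric.ball (0 : ℂ) 1) :
    HasDerivAt (resolventSymbol A α τ) ((-α * (1 - ξ)⁻¹ * beSymbol α τ ξ) •
      -(resolventSymbol A α τ ξ * resolventSymbol A α τ ξ)) ξ := by
  have hπ : α * Real.pi / 2 ≤ Real.pi := by nlinarith [Real.pi_pos]
  exact HasDerivAt.scomp ξ (hasDerivAt_resolventFun hπ hA hM
    (beSymbol_mem_sector (by linarith) hα2 hτ hξ)) (hasDerivAt_beSymbol α τ hξ)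

theorem hasDerivAt_smulResolventSymbol (hα1 : 1 < α) (hα2 : α < 2) (hτ : 0 < τ)
    (hA : IsSectorial A (α * Real.pi / 2)) (hM : ResolventBound A (α * Real.pi / 2) M)
    {ξ : ℂ} (hξ : ξ ∈ Metric.ball (0 : ℂ) 1) :
    HasDerivAt (smulResolventSymbol A α τ) ((1 - ξ)⁻¹ • (-α : ℂ) •
      (smulResolventSymbol A α τ ξ
        - smulResolventSymbol A α τ ξ * smulResolventSymbol A α τ ξ)) ξ := by
  refine ((hasDerivAt_beSymbol α τ hξ).smul
    (hasDerivAt_resolventSymbol hα1 hα2 hτ hA hM hξ)).congr_deriv ?_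
  simp only [smulResolventSymbol, smul_mul_assoc, mul_smul_comm]
  module

theorem norm_smulResolventSymbol_le (hα1 : 1 < α) (hα2 : α < 2) (hτ : 0 < τ)
    (hA : IsSectorial A (α * Real.pi / 2)) (hM : ResolventBound A (α * Real.pi / 2) M)
    {ξ : ℂ} (hξ : ξ ∈ Metric.ball (0 : ℂ) 1) : ‖smulResolventSymbol A α τ ξ‖ ≤ M := by
  have h := beSymbol_mem_sector (by linarith : 0 < α) hα2 hτ hξ
  exact hM _ h _ (hA.isResolvent h)

theorem smulResolventSymbol_sub_apply (hα1 : 1 < α) (hα2 : α < 2) (hτ : 0 < τ)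
    (hA : IsSectorial A (α * Real.pi / 2)) {ξ : ℂ} (hξ : ξ ∈ Metric.ball (0 : ℂ) 1)
    (x : A.domain) :
    smulResolventSymbol A α τ ξ x - x = resolventSymbol A α τ ξ (A x) := by
  have h := (hA.isResolvent (beSymbol_mem_sector (by linarith : 0 < α) hα2 hτ hξ)).left_inv x
  rw [map_sub, map_smul] at h
  simp only [smulResolventSymbol, resolventSymbol, _root_.smul_apply]
  nth_rw 2 [← h]
  abel

/-- The solution operator, up to scaling, that acts on the initial data: the coefficients of
`(1 - ξ)^{-γ} A R(z; A)`, `z = ((1 - ξ) / τ)^α`. -/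
def solOp (A : X →ₗ.[ℂ] X) (α τ γ : ℝ) : ℕ → X →L[ℂ] X :=
  taylorCoeff fun ξ => oneSubPow γ ξ • (smulResolventSymbol A α τ ξ + (-1))

theorem differentiableOn_oneSubPow (γ : ℝ) :
    DifferentiableOn ℂ (oneSubPow γ) (Metric.ball 0 1) := fun _ hξ =>
  (hasDerivAt_oneSubPow γ hξ).differentiableAt.differentiableWithinAt

theorem differentiableOn_smulResolventSymbol (hα1 : 1 < α) (hα2 : α < 2) (hτ : 0 < τ)
    (hA : IsSectorial A (α * Real.pi / 2)) (hM : ResolventBound A (α * Real.pi / 2) M) :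
    DifferentiableOn ℂ (smulResolventSymbol A α τ) (Metric.ball 0 1) := fun _ hξ =>
  (hasDerivAt_smulResolventSymbol hα1 hα2 hτ hA hM hξ).differentiableAt.differentiableWithinAt

variable [CompleteSpace X]

theorem norm_solOp_le (hα1 : 1 < α) (hα2 : α < 2) (hτ : 0 < τ)
    (hA : IsSectorial A (α * Real.pi / 2)) (hM : ResolventBound A (α * Real.pi / 2) M)
    {γ : ℝ} (hγ : -1 < γ) (m : ℕ) :
    ‖solOp A α τ γ m‖ ≤ symbolConst γ (max M 1) * (m + 1 : ℝ) ^ (γ - 1) := by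
  have hP := fun ξ hξ => hasDerivAt_smulResolventSymbol (ξ := ξ) hα1 hα2 hτ hA hM hξ
  have hb := fun ξ hξ => (norm_smulResolventSymbol_le (ξ := ξ) hα1 hα2 hτ hA hM hξ).trans
    (le_max_left M 1)
  refine norm_taylorCoeff_oneSubPow_smul_le (by linarith) hα2 hγ (le_max_right _ _) hP
    (fun ξ hξ => (hP ξ hξ).add_const (-1)) hb (fun ξ hξ => ?_) m
  refine (norm_add_le _ _).trans ?_
  have : ‖(-1 : X →L[ℂ] X)‖ ≤ 1 := by rw [norm_neg]; exact ContinuousLinearMap.norm_id_le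
  linarith [hb ξ hξ, le_max_right M 1]

/-- On D(A), zR(z) − 1 = R(z)A = z⁻¹(zR(z))A, and z⁻¹ = τ^α(1 − ξ)^{-α} moves γ to γ + α. The
coefficient estimate is then used with Q = P. -/
theorem norm_solOp_domain_le (hα1 : 1 < α) (hα2 : α < 2) (hτ : 0 < τ)
    (hA : IsSectorial A (α * Real.pi / 2)) (hM : ResolventBound A (α * Real.pi / 2) M)
    {γ : ℝ} (hγ : -1 < γ + α) (m : ℕ) (x : A.domain) :
    ‖solOp A α τ γ m x‖
      ≤ symbolConst (γ + α) (max M 1) * τ ^ α * (m + 1 : ℝ) ^ (γ + α - 1) * ‖A x‖ := by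
  have hP := fun ξ hξ => hasDerivAt_smulResolventSymbol (ξ := ξ) hα1 hα2 hτ hA hM hξ
  have hb := fun ξ hξ => (norm_smulResolventSymbol_le (ξ := ξ) hα1 hα2 hτ hA hM hξ).trans
    (le_max_left M 1)
  have hd := differentiableOn_smulResolventSymbol hα1 hα2 hτ hA hM
  have key := norm_taylorCoeff_oneSubPow_smul_le (α := α) (by linarith) hα2 hγ
    (le_max_right M 1) hP hP hb (fun ξ hξ => by linarith [hb ξ hξ, le_max_right M 1]) m
  have hτα : 0 < τ ^ α := Real.rpow_pos_of_pos hτ _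
  have e : solOp A α τ γ m x = ((τ ^ α : ℝ) : ℂ) •
      taylorCoeff (fun ξ => oneSubPow (γ + α) ξ • smulResolventSymbol A α τ ξ) m (A x) := by
    have d₁ : DifferentiableOn ℂ (fun ξ => oneSubPow γ ξ • (smulResolventSymbol A α τ ξ + (-1)))
        (Metric.ball 0 1) := (differentiableOn_oneSubPow γ).smul (hd.add_const _)
    have d₂ : DifferentiableOn ℂ
        (fun ξ => oneSubPow (γ + α) ξ • smulResolventSymbol A α τ ξ)
        (Metric.ball 0 1) := (differentiableOn_oneSubPow _).smul hd
    have h₁ := taylorCoeff_clm (ContinuousLinearMap.apply ℂ X (x : X)) d₁ m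
    have h₂ := taylorCoeff_clm (ContinuousLinearMap.apply ℂ X (A x)) d₂ m
    simp only [ContinuousLinearMap.apply_apply] at h₁ h₂
    rw [solOp, ← h₁, ← h₂, ← taylorCoeff_const_smul]
    refine congrFun (taylorCoeff_congr fun ξ hξ => ?_) m
    have h3 := smulResolventSymbol_sub_apply hα1 hα2 hτ hA hξ x
    simp only [_root_.smul_apply, _root_.add_apply, _root_.neg_apply,
      one_apply_eq_self]
    rw [← sub_eq_add_neg, h3, smulResolventSymbol, _root_.smul_apply, smul_smul, smul_smul,
      beSymbol_eq]
    congr 1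
    have e1 : oneSubPow (γ + α) ξ * oneSubPow (-α) ξ = oneSubPow γ ξ := by
      rw [← oneSubPow_add hξ]; congr 1; ring
    have e2 : ((τ ^ α : ℝ) : ℂ) * ((τ ^ (-α) : ℝ) : ℂ) = 1 := by
      rw [← Complex.ofReal_mul, ← Real.rpow_add hτ]; simp
    calc _ = oneSubPow (γ + α) ξ * oneSubPow (-α) ξ := e1.symm
      _ = (((τ ^ α : ℝ) : ℂ) * ((τ ^ (-α) : ℝ) : ℂ)) *
          (oneSubPow (γ + α) ξ * oneSubPow (-α) ξ) := by rw [e2, one_mul]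
      _ = _ := by ring
  rw [e, norm_smul, Complex.norm_real, Real.norm_of_nonneg hτα.le]
  calc _ ≤ τ ^ α * ((symbolConst (γ + α) (max M 1) * (m + 1 : ℝ) ^ (γ + α - 1)) * ‖A x‖) := by
        gcongr
        exact (ContinuousLinearMap.le_opNorm _ _).trans (by gcongr)
    _ = _ := by ring

theorem coeff_smulResolventSymbol_sub_apply (hα1 : 1 < α) (hα2 : α < 2) (hτ : 0 < τ)
    (hA : IsSectorial A (α * Real.pi / 2)) (hM : ResolventBound A (α * Real.pi / 2) M)
    (m : ℕ) (x : A.domain) :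
    taylorCoeff (fun ξ => smulResolventSymbol A α τ ξ + (-1)) m x
      = taylorCoeff (resolventSymbol A α τ) m (A x) := by
  have hd := differentiableOn_smulResolventSymbol hα1 hα2 hτ hA hM
  have hr : DifferentiableOn ℂ (resolventSymbol A α τ) (Metric.ball 0 1) := fun _ hξ =>
    (hasDerivAt_resolventSymbol hα1 hα2 hτ hA hM hξ).differentiableAt.differentiableWithinAt
  have h₁ := taylorCoeff_clm (ContinuousLinearMap.apply ℂ X (x : X)) (hd.add_const (-1)) m
  have h₂ := taylorCoeff_clm (ContinuousLinearMap.apply ℂ X (A x)) hr m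
  simp only [ContinuousLinearMap.apply_apply] at h₁ h₂
  rw [← h₁, ← h₂]
  refine congrFun (taylorCoeff_congr fun ξ hξ => ?_) m
  rw [← smulResolventSymbol_sub_apply hα1 hα2 hτ hA hξ x]
  simp [sub_eq_add_neg]

theorem conv_one_sub_solOp (hα1 : 1 < α) (hα2 : α < 2) (hτ : 0 < τ)
    (hA : IsSectorial A (α * Real.pi / 2)) (hM : ResolventBound A (α * Real.pi / 2) M)
    (γ : ℝ) :
    conv (taylorCoeff fun ξ : ℂ => 1 - ξ) (solOp A α τ (γ + 1)) = solOp A α τ γ := by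
  have hd := differentiableOn_smulResolventSymbol hα1 hα2 hτ hA hM
  have hQ : DifferentiableOn ℂ
      (fun ξ => oneSubPow (γ + 1) ξ • (smulResolventSymbol A α τ ξ + (-1)))
      (Metric.ball 0 1) := (differentiableOn_oneSubPow _).smul (hd.add_const _)
  rw [solOp, ← taylorCoeff_smul (h := fun ξ => 1 - ξ) (differentiableOn_id.const_sub 1) hQ, solOp]
  refine taylorCoeff_congr fun ξ hξ => ?_
  have := one_sub_ne_zero hξ
  rw [oneSubPow_add hξ, oneSubPow_one, smul_smul]
  congr 1
  field_simp

/-- The data sequence has generating function ξ(1 − ξ)⁻¹v. Moving the factor 1 − ξ onto it takes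
backward differences, which leave v at index 1 only. -/
theorem opConv_solOp_const (hα1 : 1 < α) (hα2 : α < 2) (hτ : 0 < τ)
    (hA : IsSectorial A (α * Real.pi / 2)) (hM : ResolventBound A (α * Real.pi / 2) M)
    (γ : ℝ) (v : X) (n : ℕ) :
    opConv (solOp A α τ γ) (fun k => if k = 0 then 0 else v) (n + 1)
      = solOp A α τ (γ + 1) n v := by
  rw [← conv_one_sub_solOp hα1 hα2 hτ hA hM, ← conv_opConv, ← opConv_conv,
    ← opConv_single_one]
  congr 1
  funext k
  rcases k with _ | _ | k
  · simp [conv_one_sub_zero]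
  · simp [conv_one_sub_succ]
  · simp [conv_one_sub_succ]

/-- Backward differences of kw give w for k ≥ 1 and 0 at k = 0, so this reduces to the constant
case. -/
theorem opConv_solOp_linear (hα1 : 1 < α) (hα2 : α < 2) (hτ : 0 < τ)
    (hA : IsSectorial A (α * Real.pi / 2)) (hM : ResolventBound A (α * Real.pi / 2) M)
    (γ : ℝ) (w : X) (n : ℕ) :
    opConv (solOp A α τ γ) (fun k => (k : ℂ) • w) (n + 1)
      = solOp A α τ (γ + 2) n w := by
  rw [show γ + 2 = γ + 1 + 1 by ring, ← opConv_solOp_const hα1 hα2 hτ hA hM,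
    ← conv_one_sub_solOp hα1 hα2 hτ hA hM γ, ← conv_opConv, ← opConv_conv]
  congr 1
  funext k
  rcases k with _ | k
  · simp [conv_one_sub_zero]
  · rw [conv_one_sub_succ, ← sub_smul]; simp

/-- Representation of the discrete Caputo derivative of the solution by the initial data. -/
theorem IsBESolution.caputoBE_eq (hα1 : 1 < α) (hα2 : α < 2) (hτ : 0 < τ)
    (hA : IsSectorial A (α * Real.pi / 2)) (hM : ResolventBound A (α * Real.pi / 2) M)
    {v w : X} {u : ℕ → X} (hu : IsBESolution A α τ v w u) (n : ℕ) :
    caputoBE α τ v w u (n + 1) = ((τ ^ (-α) : ℝ) : ℂ) •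
      (solOp A α τ (1 - α) n v + (τ : ℂ) • solOp A α τ (2 - α) n w) := by
  set d := taylorCoeff (beSymbol α τ) with hd
  set s := taylorCoeff (resolventSymbol A α τ) with hs
  set q := taylorCoeff (fun ξ => smulResolventSymbol A α τ ξ + (-1)) with hq
  -- The initial value v need not lie in D(A). As u^0 − v = 0, setting both u and the data to 0 at
  -- index 0 leaves the difference unchanged, and the equation then holds at every index.
  set u' : ℕ → X := fun k => if k = 0 then 0 else u k with hu'
  set g : ℕ → X := (fun k : ℕ => if k = 0 then 0 else v) + fun k : ℕ => (k : ℂ) • (τ : ℂ) • w with hg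
  have dP := differentiableOn_smulResolventSymbol hα1 hα2 hτ hA hM
  have dR : DifferentiableOn ℂ (resolventSymbol A α τ) (Metric.ball 0 1) := fun _ hξ =>
    (hasDerivAt_resolventSymbol hα1 hα2 hτ hA hM hξ).differentiableAt.differentiableWithinAt
  have dζ : DifferentiableOn ℂ (beSymbol α τ) (Metric.ball 0 1) := fun _ hξ =>
    (hasDerivAt_beSymbol α τ hξ).differentiableAt.differentiableWithinAt
  have hD : caputoBE α τ v w u = conv d (u' - g) := by
    funext k
    rw [caputoBE, beDeriv_eq_conv]
    congr 1
    funext j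
    rcases j with _ | j
    · simp [hu', hg, hu.init]
    · simp only [hu', hg, Pi.sub_apply, Pi.add_apply, j.succ_ne_zero, if_false, smul_smul]
      push_cast
      abel
  have hmem : ∀ k, u' k ∈ A.domain := fun k => by
    rcases k with _ | k
    · simp [hu']
    · simpa [hu'] using hu.mem_domain (k + 1) (by omega)
  have hDA : ∀ k, conv d (u' - g) k = A ⟨u' k, hmem k⟩ := fun k => by
    rcases k with _ | k
    · have h0 : (u' - g) 0 = 0 := by simp [hu', hg]
      have h1 : (⟨u' 0, hmem 0⟩ : A.domain) = 0 := by ext; simp [hu']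
      rw [h1, A.map_zero]
      exact (sum_eq_zero fun ij hij => by
        have := mem_antidiagonal.1 hij
        rw [show ij.2 = 0 by omega, h0, smul_zero])
    · rw [← hD, hu.scheme (k + 1) (by omega), opVal, dif_pos (hu.mem_domain (k + 1) (by omega))]
      rfl
  have hp : conv d s = q + Pi.single 0 1 := by
    rw [hd, hs, ← taylorCoeff_smul dζ dR]
    funext k
    have := taylorCoeff_add_const (f := fun ξ => smulResolventSymbol A α τ ξ + (-1)) 1 k
    rw [hq, Pi.add_apply, ← this]
    refine congrFun (taylorCoeff_congr fun ξ _ => ?_) k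
    simp [smulResolventSymbol]
  -- The resolvent is applied to z(U − G) = AU, using R(z)A = zR(z) − 1 on D(A).
  have h1 : opConv s (conv d (u' - g)) = opConv q u' := by
    funext k
    simp only [opConv]
    refine sum_congr rfl fun ij _ => ?_
    rw [hDA, hs, hq, ← coeff_smulResolventSymbol_sub_apply hα1 hα2 hτ hA hM]
  rw [opConv_conv, conv_opConv, hp, opConv_add_single_zero, opConv_sub] at h1
  -- From (zR)(U − G) = (zR − 1)U the terms in U cancel up to U − G = (zR − 1)G.
  have h2 : u' - g = opConv q g := by
    have : opConv q u' - opConv q g + (u' - g) = opConv q u' + ((u' - g) - opConv q g) := by abel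
    rw [this] at h1
    exact sub_eq_zero.1 (add_eq_left.1 h1)
  have hdq : conv d q = ((τ ^ (-α) : ℝ) : ℂ) • solOp A α τ (-α) := by
    rw [hd, hq, ← taylorCoeff_smul dζ (dP.add_const _)]
    funext k
    rw [Pi.smul_apply, solOp, ← taylorCoeff_const_smul]
    refine congrFun (taylorCoeff_congr fun ξ _ => ?_) k
    rw [beSymbol_eq, mul_smul]
  have hsm : ∀ (c : ℂ) (a : ℕ → X →L[ℂ] X) y k, opConv (c • a) y k = c • opConv a y k := by
    intro c a y k
    simp [opConv, smul_sum]
  rw [hD, h2, conv_opConv, hdq, hsm, hg, opConv_add, Pi.add_apply,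
    opConv_solOp_const hα1 hα2 hτ hA hM, opConv_solOp_linear hα1 hα2 hτ hA hM, map_smul,
    show -α + 1 = 1 - α by ring, show -α + 2 = 2 - α by ring]

end Scheme

/-! ### Pointwise bounds by the K-functional -/

section KFunctional

variable {X : Type*} [NormedAddCommGroup X] [NormedSpace ℂ X] (A : X →ₗ.[ℂ] X)

theorem kFunctional_bddBelow {t : ℝ} (ht : 0 ≤ t) (x : X) :
    BddBelow (Set.range fun b : A.domain => ‖x - b‖ + t * (‖(b : X)‖ + ‖A b‖)) :=
  ⟨0, by rintro _ ⟨b, rfl⟩; positivity⟩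

theorem kFunctional_nonneg {t : ℝ} (ht : 0 ≤ t) (x : X) : 0 ≤ kFunctional A t x :=
  Real.iInf_nonneg fun b => by positivity

theorem kFunctional_mono {s t : ℝ} (hs : 0 ≤ s) (hst : s ≤ t) (x : X) :
    kFunctional A s x ≤ kFunctional A t x :=
  ciInf_mono (kFunctional_bddBelow A hs x) fun b => by gcongr

variable {A} {α τ M : ℝ} [CompleteSpace X]

/-- For x = (x − b) + b with b ∈ D(A), the bounds of the two parts differ by the factor ((m +
1)τ)^α, the argument of K; then take the infimum over b. -/
theorem norm_solOp_le_kFunctional (hα1 : 1 < α) (hα2 : α < 2) (hτ : 0 < τ)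
    (hA : IsSectorial A (α * Real.pi / 2)) (hM : ResolventBound A (α * Real.pi / 2) M)
    {γ : ℝ} (hγ : -1 < γ) (m : ℕ) (x : X) :
    ‖solOp A α τ γ m x‖ ≤ (symbolConst γ (max M 1) + symbolConst (γ + α) (max M 1)) *
      (m + 1 : ℝ) ^ (γ - 1) * kFunctional A (((m + 1 : ℕ) * τ) ^ α) x := by
  have hB : 0 ≤ max M 1 := zero_le_one.trans (le_max_right _ _)
  have h1 := symbolConst_nonneg hγ hB
  have h2 := symbolConst_nonneg (show -1 < γ + α by linarith) hB
  set S := symbolConst γ (max M 1)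
  set S' := symbolConst (γ + α) (max M 1)
  have hm : (0 : ℝ) < m + 1 := by positivity
  rw [kFunctional, Real.mul_iInf_of_nonneg (by positivity)]
  refine le_ciInf fun b => ?_
  have e : ((m + 1 : ℕ) * τ) ^ α = (m + 1 : ℝ) ^ α * τ ^ α := by
    rw [← Real.mul_rpow hm.le hτ.le]; push_cast; rfl
  have e' : (m + 1 : ℝ) ^ (γ + α - 1) = (m + 1 : ℝ) ^ (γ - 1) * (m + 1 : ℝ) ^ α := by
    rw [← Real.rpow_add hm]; congr 1; ring
  have hb := norm_solOp_domain_le hα1 hα2 hτ hA hM (show -1 < γ + α by linarith) m b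
  have hx : ‖solOp A α τ γ m (x - b)‖ ≤ S * (m + 1 : ℝ) ^ (γ - 1) * ‖x - b‖ :=
    (ContinuousLinearMap.le_opNorm _ _).trans
      (by gcongr; exact norm_solOp_le hα1 hα2 hτ hA hM hγ m)
  have hτα : 0 < τ ^ α := Real.rpow_pos_of_pos hτ _
  calc ‖solOp A α τ γ m x‖ = ‖solOp A α τ γ m (x - b) + solOp A α τ γ m b‖ := by
        rw [← map_add, sub_add_cancel]
    _ ≤ S * (m + 1 : ℝ) ^ (γ - 1) * ‖x - b‖
        + S' * τ ^ α * (m + 1 : ℝ) ^ (γ + α - 1) * ‖A b‖ := (norm_add_le _ _).trans (by gcongr)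
    _ ≤ (S + S') * (m + 1 : ℝ) ^ (γ - 1) * ‖x - b‖
        + (S + S') * τ ^ α * (m + 1 : ℝ) ^ (γ + α - 1) * (‖(b : X)‖ + ‖A b‖) := by
        gcongr
        · linarith
        · linarith
        · linarith [norm_nonneg (b : X)]
    _ = _ := by rw [e, e']; ring

/-- The constant in the pointwise bounds of the scheme. -/
def schemeConst (α M : ℝ) : ℝ :=
  symbolConst (1 - α) (max M 1) + symbolConst 1 (max M 1)
    + symbolConst (2 - α) (max M 1) + symbolConst 2 (max M 1)

theorem schemeConst_nonneg (α M : ℝ) (hα2 : α < 2) : 0 ≤ schemeConst α M := by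
  have hB : 0 ≤ max M 1 := zero_le_one.trans (le_max_right _ _)
  have := symbolConst_nonneg (show -1 < 1 - α by linarith) hB
  have := symbolConst_nonneg (show -1 < (1 : ℝ) by linarith) hB
  have := symbolConst_nonneg (show -1 < 2 - α by linarith) hB
  have := symbolConst_nonneg (show -1 < (2 : ℝ) by linarith) hB
  unfold schemeConst; positivity

/-- The minimum keeps both bounds of the w-term: K serves the supercritical case, ‖w‖ the other two.
-/
theorem IsBESolution.norm_caputoBE_le (hα1 : 1 < α) (hα2 : α < 2) (hτ : 0 < τ)
    (hA : IsSectorial A (α * Real.pi / 2)) (hM : ResolventBound A (α * Real.pi / 2) M)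
    {v w : X} {u : ℕ → X} (hu : IsBESolution A α τ v w u) {n : ℕ} (hn : 1 ≤ n) :
    ‖caputoBE α τ v w u n‖ ≤ schemeConst α M *
      ((n * τ) ^ (-α) * kFunctional A ((n * τ) ^ α) v
        + (n * τ) ^ (-(α - 1)) * min (kFunctional A ((n * τ) ^ α) w) ‖w‖) := by
  obtain ⟨m, rfl⟩ : ∃ m, n = m + 1 := ⟨n - 1, by omega⟩
  have hB : 0 ≤ max M 1 := zero_le_one.trans (le_max_right _ _)
  have s1 := symbolConst_nonneg (show -1 < 1 - α by linarith) hB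
  have s2 := symbolConst_nonneg (show -1 < (1 : ℝ) by linarith) hB
  have s3 := symbolConst_nonneg (show -1 < 2 - α by linarith) hB
  have s4 := symbolConst_nonneg (show -1 < (2 : ℝ) by linarith) hB
  have hv := norm_solOp_le_kFunctional hα1 hα2 hτ hA hM (show -1 < 1 - α by linarith) m v
  have hw := norm_solOp_le_kFunctional hα1 hα2 hτ hA hM (show -1 < 2 - α by linarith) m w
  have hw' : ‖solOp A α τ (2 - α) m w‖ ≤
      symbolConst (2 - α) (max M 1) * (m + 1 : ℝ) ^ (2 - α - 1) * ‖w‖ :=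
    (ContinuousLinearMap.le_opNorm _ _).trans
      (by gcongr; exact norm_solOp_le hα1 hα2 hτ hA hM (by linarith) m)
  rw [show 1 - α + α = 1 by ring, show 1 - α - 1 = -α by ring] at hv
  rw [show 2 - α + α = 2 by ring, show 2 - α - 1 = -(α - 1) by ring] at hw
  rw [show 2 - α - 1 = -(α - 1) by ring] at hw'
  have hm : (0 : ℝ) < m + 1 := by positivity
  have ht : (0 : ℝ) ≤ ((m + 1 : ℕ) * τ) ^ α := by positivity
  set Kv := kFunctional A (((m + 1 : ℕ) * τ) ^ α) v
  set Kw := kFunctional A (((m + 1 : ℕ) * τ) ^ α) w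
  have hKv : 0 ≤ Kv := kFunctional_nonneg A ht v
  have hKw : 0 ≤ Kw := kFunctional_nonneg A ht w
  have hCv : symbolConst (1 - α) (max M 1) + symbolConst 1 (max M 1) ≤ schemeConst α M := by
    unfold schemeConst; linarith
  have hCw : symbolConst (2 - α) (max M 1) + symbolConst 2 (max M 1) ≤ schemeConst α M := by
    unfold schemeConst; linarith
  have hCw' : symbolConst (2 - α) (max M 1) ≤ schemeConst α M := by
    unfold schemeConst; linarith
  have bv : ‖solOp A α τ (1 - α) m v‖ ≤ schemeConst α M * (m + 1 : ℝ) ^ (-α) * Kv :=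
    hv.trans (by gcongr)
  have bw : ‖solOp A α τ (2 - α) m w‖
      ≤ schemeConst α M * (m + 1 : ℝ) ^ (-(α - 1)) * min Kw ‖w‖ := by
    rcases min_choice Kw ‖w‖ with h | h <;> rw [h]
    · exact hw.trans (by gcongr)
    · exact hw'.trans (by gcongr)
  rw [hu.caputoBE_eq hα1 hα2 hτ hA hM, norm_smul, Complex.norm_real,
    Real.norm_of_nonneg (by positivity)]
  have hn : ‖solOp A α τ (1 - α) m v + (τ : ℂ) • solOp A α τ (2 - α) m w‖
      ≤ ‖solOp A α τ (1 - α) m v‖ + τ * ‖solOp A α τ (2 - α) m w‖ := by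
    refine (norm_add_le _ _).trans (le_of_eq ?_)
    rw [norm_smul, Complex.norm_real, Real.norm_of_nonneg hτ.le]
  have e1 : ((m + 1 : ℕ) * τ) ^ (-α) = (m + 1 : ℝ) ^ (-α) * τ ^ (-α) := by
    rw [← Real.mul_rpow hm.le hτ.le]; push_cast; rfl
  have e2 : ((m + 1 : ℕ) * τ) ^ (-(α - 1)) = (m + 1 : ℝ) ^ (-(α - 1)) * (τ ^ (-α) * τ) := by
    have : τ ^ (-α) * τ = τ ^ (-(α - 1)) := by
      nth_rw 2 [← Real.rpow_one τ]; rw [← Real.rpow_add hτ]; congr 1; ring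
    rw [this, ← Real.mul_rpow hm.le hτ.le]; push_cast; rfl
  calc _ ≤ τ ^ (-α) * (schemeConst α M * (m + 1 : ℝ) ^ (-α) * Kv
        + τ * (schemeConst α M * (m + 1 : ℝ) ^ (-(α - 1)) * min Kw ‖w‖)) := by
        gcongr
        exact hn.trans (by gcongr)
    _ = _ := by rw [e1, e2]; ring

end KFunctional

/-! ### Discrete strong and weak L^p norms -/

section Norms

variable {X : Type*} [NormedAddCommGroup X]

/-- The scheme equates D^n and Au^n for n ≥ 1 only; the norm does not see index 0. -/
theorem LpNorm_congr {p : ℝ≥0∞} {τ : ℝ} {N : ℕ} {f g : ℕ → X}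
    (h : ∀ n, 1 ≤ n → f n = g n) : LpNorm p τ N f = LpNorm p τ N g := by
  have h' : ∀ n ∈ Finset.Icc 1 N, f n = g n := fun n hn => h n (Finset.mem_Icc.1 hn).1
  unfold LpNorm
  split_ifs
  · exact iSup_congr fun n => iSup_congr fun hn => by rw [h' n hn]
  · congr 2
    exact sum_congr rfl fun n hn => by rw [h' n hn]

theorem weakLpNorm_congr {p τ : ℝ} {N : ℕ} {f g : ℕ → X}
    (h : ∀ n, 1 ≤ n → f n = g n) : weakLpNorm p τ N f = weakLpNorm p τ N g := by
  unfold weakLpNorm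
  refine iSup_congr fun l => iSup_congr fun _ => ?_
  rw [filter_congr fun n hn => by rw [h n (Finset.mem_Icc.1 hn).1]]

theorem LpNorm_le_of_norm_le {p : ℝ≥0∞} (hp : 1 ≤ p) {τ C : ℝ} (hC : 0 ≤ C) {N : ℕ} {f : ℕ → X}
    {a b : ℕ → ℝ} (ha : ∀ n, 0 ≤ a n) (hb : ∀ n, 0 ≤ b n)
    (h : ∀ n, 1 ≤ n → ‖f n‖ ≤ C * (a n + b n)) :
    LpNorm p τ N f ≤ ENNReal.ofReal C * (LpNorm p τ N a + LpNorm p τ N b) := by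
  have h' : ∀ n ∈ Finset.Icc 1 N, ‖f n‖ₑ ≤ ENNReal.ofReal C * (‖a n‖ₑ + ‖b n‖ₑ) := fun n hn => by
    rw [Real.enorm_of_nonneg (ha n), Real.enorm_of_nonneg (hb n),
      ← ENNReal.ofReal_add (ha n) (hb n), ← ENNReal.ofReal_mul hC, ← ofReal_norm]
    exact ENNReal.ofReal_le_ofReal (h n (Finset.mem_Icc.1 hn).1)
  unfold LpNorm
  split_ifs with hpt
  · refine iSup₂_le fun n hn => (h' n hn).trans ?_
    gcongr
    · exact le_iSup₂ (f := fun n (_ : n ∈ Finset.Icc 1 N) => ‖a n‖ₑ) n hn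
    · exact le_iSup₂ (f := fun n (_ : n ∈ Finset.Icc 1 N) => ‖b n‖ₑ) n hn
  · have hr : 1 ≤ p.toReal := by
      rw [← ENNReal.toReal_one]; exact ENNReal.toReal_mono hpt hp
    set r := p.toReal
    have hr0 : 0 < r := by linarith
    have hri : 0 ≤ r⁻¹ := by positivity
    have hm := ENNReal.Lp_add_le (Finset.Icc 1 N) (fun n => ‖a n‖ₑ) (fun n => ‖b n‖ₑ) hr
    simp only [one_div] at hm
    calc _ ≤ (ENNReal.ofReal τ *
          ∑ n ∈ Finset.Icc 1 N, (ENNReal.ofReal C * (‖a n‖ₑ + ‖b n‖ₑ)) ^ r) ^ r⁻¹ := by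
          gcongr with n hn
          exact h' n hn
      _ = ENNReal.ofReal C * (ENNReal.ofReal τ ^ r⁻¹ *
          (∑ n ∈ Finset.Icc 1 N, (‖a n‖ₑ + ‖b n‖ₑ) ^ r) ^ r⁻¹) := by
          simp only [ENNReal.mul_rpow_of_nonneg _ _ hr0.le, ← mul_sum,
            ENNReal.mul_rpow_of_nonneg _ _ hri, ENNReal.rpow_rpow_inv hr0.ne']
          ring
      _ ≤ ENNReal.ofReal C * (ENNReal.ofReal τ ^ r⁻¹ *
          ((∑ n ∈ Finset.Icc 1 N, ‖a n‖ₑ ^ r) ^ r⁻¹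
            + (∑ n ∈ Finset.Icc 1 N, ‖b n‖ₑ ^ r) ^ r⁻¹)) := by gcongr
      _ = _ := by
          rw [mul_add (ENNReal.ofReal τ ^ r⁻¹), ENNReal.mul_rpow_of_nonneg _ _ hri,
            ENNReal.mul_rpow_of_nonneg _ _ hri]

theorem LpNorm_eq_ofReal {p : ℝ≥0∞} (hp : p ≠ ∞) {τ : ℝ} (hτ : 0 < τ) {N : ℕ}
    {a : ℕ → ℝ} (ha : ∀ n, 0 ≤ a n) :
    LpNorm p τ N a
      = ENNReal.ofReal ((τ * ∑ n ∈ Finset.Icc 1 N, a n ^ p.toReal) ^ p.toReal⁻¹) := by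
  have hs : 0 ≤ ∑ n ∈ Finset.Icc 1 N, a n ^ p.toReal :=
    sum_nonneg fun n _ => Real.rpow_nonneg (ha n) _
  rw [LpNorm, if_neg hp, ← ENNReal.ofReal_rpow_of_nonneg (by positivity) (by positivity),
    ENNReal.ofReal_mul hτ.le, ENNReal.ofReal_sum_of_nonneg fun n _ => Real.rpow_nonneg (ha n) _]
  congr 2
  refine sum_congr rfl fun n _ => ?_
  rw [Real.enorm_of_nonneg (ha n), ENNReal.ofReal_rpow_of_nonneg (ha n) ENNReal.toReal_nonneg]

theorem sum_rpow_neg_le {q : ℝ} (hq0 : 0 ≤ q) (hq : q < 1) (N : ℕ) :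
    ∑ n ∈ Finset.Icc 1 N, (n : ℝ) ^ (-q) ≤ (N : ℝ) ^ (1 - q) / (1 - q) := by
  have hq1 : 0 < 1 - q := by linarith
  induction N with
  | zero => simp [Real.zero_rpow hq1.ne']
  | succ N ih =>
    rw [← Finset.insert_Icc_right_eq_Icc_add_one (by omega), sum_insert (by simp)]
    have hN : (0 : ℝ) < N + 1 := by positivity
    -- Bernoulli's inequality for the exponent 1 − q ≤ 1 bounds the new summand by the increment of
    -- N^{1−q}/(1 − q).
    have key := rpow_one_add_le_one_add_mul_self (s := -(1 / (N + 1 : ℝ)))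
      (by rw [neg_le_neg_iff, div_le_one hN]; linarith [(N.cast_nonneg : (0 : ℝ) ≤ N)])
      hq1.le (by linarith)
    have e : (1 + -(1 / (N + 1 : ℝ))) = N / (N + 1) := by field_simp; ring
    rw [e, Real.div_rpow (by positivity) hN.le, div_le_iff₀ (by positivity)] at key
    have e2 : (N + 1 : ℝ) ^ (1 - q) = (N + 1) * (N + 1 : ℝ) ^ (-q) := by
      rw [sub_eq_add_neg, Real.rpow_add hN, Real.rpow_one]
    have e3 : (1 + (1 - q) * -(1 / (N + 1 : ℝ))) * (N + 1 : ℝ) ^ (1 - q)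
        = (N + 1 : ℝ) ^ (1 - q) - (1 - q) * (N + 1 : ℝ) ^ (-q) := by
      rw [e2]; field_simp; ring
    rw [e3] at key
    push_cast
    rw [le_div_iff₀ hq1] at ih ⊢
    linarith

theorem LpNorm_rpow_mul_le {p : ℝ≥0∞} (hp1 : 1 ≤ p) (hp : p ≠ ∞) {τ κ : ℝ} (hτ : 0 < τ)
    (hκ : 0 ≤ κ) (hq : κ * p.toReal < 1) {W : ℝ} (hW : 0 ≤ W) (N : ℕ) :
    LpNorm p τ N (fun n : ℕ => (n * τ) ^ (-κ) * W)
      ≤ ENNReal.ofReal ((1 - κ * p.toReal)⁻¹ ^ p.toReal⁻¹) *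
        (ENNReal.ofReal ((N * τ) ^ (p⁻¹.toReal - κ)) * ENNReal.ofReal W) := by
  have hr : 1 ≤ p.toReal := by
    rw [← ENNReal.toReal_one]; exact ENNReal.toReal_mono hp hp1
  rw [LpNorm_eq_ofReal hp hτ fun n => by positivity, ENNReal.toReal_inv]
  set r := p.toReal
  have hr0 : 0 < r := by linarith
  have hq1 : 0 < 1 - κ * r := by linarith
  rw [← ENNReal.ofReal_mul (by positivity), ← ENNReal.ofReal_mul (by positivity)]
  refine ENNReal.ofReal_le_ofReal ?_
  have e : ∀ n ∈ Finset.Icc 1 N, ((n * τ) ^ (-κ) * W) ^ r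
      = τ ^ (-(κ * r)) * W ^ r * (n : ℝ) ^ (-(κ * r)) := fun n _ => by
    rw [Real.mul_rpow (by positivity) hW, ← Real.rpow_mul (by positivity),
      Real.mul_rpow (by positivity) hτ.le, neg_mul]
    ring
  rw [sum_congr rfl e, ← mul_sum]
  have hs := sum_rpow_neg_le (by positivity) hq N
  have e1 : τ * τ ^ (-(κ * r)) = τ ^ (1 - κ * r) := by
    rw [sub_eq_add_neg, Real.rpow_add hτ, Real.rpow_one]
  calc _ ≤ (τ * (τ ^ (-(κ * r)) * W ^ r * ((N : ℝ) ^ (1 - κ * r) / (1 - κ * r)))) ^ r⁻¹ := by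
        gcongr
    _ = ((1 - κ * r)⁻¹ * ((N * τ) ^ (1 - κ * r) * W ^ r)) ^ r⁻¹ := by
        rw [Real.mul_rpow (by positivity) hτ.le, ← e1]; ring_nf
    _ = _ := by
        rw [Real.mul_rpow (by positivity) (by positivity),
          Real.mul_rpow (by positivity) (by positivity), Real.rpow_rpow_inv hW hr0.ne',
          ← Real.rpow_mul (by positivity)]
        congr 4
        field_simp

/-- Where ‖f‖ exceeds l, one of the two summands exceeds l/(2C). Chebyshev's inequality counts the
indices for the first; for the second they satisfy nτ ≤ (2CW/l)^p. The p-th root is subadditive as p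
≥ 1. -/
theorem weakLpNorm_le_of_norm_le {p : ℝ≥0∞} (hp1 : 1 ≤ p) (hp : p ≠ ∞) {τ C W : ℝ} (hτ : 0 < τ)
    (hC : 0 ≤ C) (hW : 0 ≤ W) {N : ℕ} {f : ℕ → X} {a : ℕ → ℝ} (ha : ∀ n, 0 ≤ a n)
    (h : ∀ n : ℕ, 1 ≤ n → ‖f n‖ ≤ C * (a n + (n * τ) ^ (-p.toReal⁻¹) * W)) :
    weakLpNorm p.toReal τ N f
      ≤ ENNReal.ofReal (2 * C) * (LpNorm p τ N a + ENNReal.ofReal W) := by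
  have hr : 1 ≤ p.toReal := by
    rw [← ENNReal.toReal_one]; exact ENNReal.toReal_mono hp hp1
  rw [LpNorm_eq_ofReal hp hτ ha]
  set r := p.toReal
  have hr0 : 0 < r := by linarith
  have hs : 0 ≤ ∑ n ∈ Finset.Icc 1 N, a n ^ r := sum_nonneg fun n _ => Real.rpow_nonneg (ha n) _
  rw [← ENNReal.ofReal_add (by positivity) hW, ← ENNReal.ofReal_mul (by positivity)]
  refine iSup₂_le fun l hl => ENNReal.ofReal_le_ofReal ?_
  set S₁ := (Finset.Icc 1 N).filter fun n => l < 2 * C * a n with hS₁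
  set S₂ := (Finset.Icc 1 N).filter fun n : ℕ => l < 2 * C * ((n * τ) ^ (-r⁻¹) * W) with hS₂
  have hcard : (((Finset.Icc 1 N).filter fun n => l < ‖f n‖).card : ℝ) ≤ S₁.card + S₂.card := by
    have hsub : ((Finset.Icc 1 N).filter fun n => l < ‖f n‖) ⊆ S₁ ∪ S₂ := fun n hn => by
      obtain ⟨hn1, hn2⟩ := Finset.mem_filter.1 hn
      have hle := h n (Finset.mem_Icc.1 hn1).1
      rw [Finset.mem_union, hS₁, hS₂, Finset.mem_filter, Finset.mem_filter]
      by_contra hcon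
      push Not at hcon
      have h1 := hcon.1 hn1
      have h2 := hcon.2 hn1
      linarith
    exact_mod_cast (Finset.card_le_card hsub).trans (Finset.card_union_le _ _)
  have hb₁ : l * ((S₁.card : ℝ) * τ) ^ r⁻¹ ≤ 2 * C * (τ * ∑ n ∈ Finset.Icc 1 N, a n ^ r) ^ r⁻¹ := by
    have h1 : (S₁.card : ℝ) * l ^ r ≤ (2 * C) ^ r * ∑ n ∈ Finset.Icc 1 N, a n ^ r := by
      rw [mul_sum, ← nsmul_eq_mul]
      calc _ ≤ ∑ n ∈ S₁, (2 * C) ^ r * a n ^ r := by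
            refine Finset.card_nsmul_le_sum _ _ _ fun n hn => ?_
            rw [← Real.mul_rpow (by positivity) (ha n)]
            exact Real.rpow_le_rpow hl.le (Finset.mem_filter.1 hn).2.le hr0.le
        _ ≤ _ := Finset.sum_le_sum_of_subset_of_nonneg (Finset.filter_subset _ _)
            fun n _ _ => mul_nonneg (by positivity) (Real.rpow_nonneg (ha n) _)
    calc l * ((S₁.card : ℝ) * τ) ^ r⁻¹ = ((S₁.card * l ^ r) * τ) ^ r⁻¹ := by
          rw [show (S₁.card * l ^ r) * τ = l ^ r * (S₁.card * τ) by ring,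
            Real.mul_rpow (x := l ^ r) (by positivity) (by positivity),
            Real.rpow_rpow_inv hl.le hr0.ne']
      _ ≤ (((2 * C) ^ r * ∑ n ∈ Finset.Icc 1 N, a n ^ r) * τ) ^ r⁻¹ := by gcongr
      _ = _ := by
          rw [mul_assoc, Real.mul_rpow (by positivity) (by positivity),
            Real.rpow_rpow_inv (by positivity) hr0.ne', mul_comm τ]
  have hb₂ : l * ((S₂.card : ℝ) * τ) ^ r⁻¹ ≤ 2 * C * W := by
    have h1 : (S₂.card : ℝ) * τ ≤ (2 * C * W / l) ^ r := by
      rw [← le_div_iff₀ hτ]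
      have hsub : S₂ ⊆ Finset.Icc 1 ⌊(2 * C * W / l) ^ r / τ⌋₊ := fun n hn => by
        obtain ⟨hn1, hn2⟩ := Finset.mem_filter.1 hn
        have hn1 := (Finset.mem_Icc.1 hn1).1
        have hnτ : 0 < (n : ℝ) * τ := by
          have : (0 : ℝ) < n := by exact_mod_cast hn1
          positivity
        refine Finset.mem_Icc.2 ⟨hn1, Nat.le_floor ?_⟩
        rw [le_div_iff₀ hτ]
        rw [Real.rpow_neg hnτ.le] at hn2
        have h2 : (n * τ) ^ r⁻¹ ≤ 2 * C * W / l := by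
          have hpos : 0 < ((n : ℝ) * τ) ^ r⁻¹ := Real.rpow_pos_of_pos hnτ _
          rw [le_div_iff₀ hl, mul_comm]
          refine (mul_lt_mul_of_pos_right hn2 hpos).le.trans (le_of_eq ?_)
          field_simp
        calc (n : ℝ) * τ = ((n * τ) ^ r⁻¹) ^ r := (Real.rpow_inv_rpow hnτ.le hr0.ne').symm
          _ ≤ _ := Real.rpow_le_rpow (by positivity) h2 hr0.le
      have h3 := Finset.card_le_card hsub
      rw [Nat.card_Icc, Nat.add_sub_cancel] at h3
      exact (by exact_mod_cast h3 : (S₂.card : ℝ) ≤ (⌊(2 * C * W / l) ^ r / τ⌋₊ : ℝ)).trans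
        (Nat.floor_le (by positivity))
    calc _ ≤ l * ((2 * C * W / l) ^ r) ^ r⁻¹ := by gcongr
      _ = _ := by
          rw [Real.rpow_rpow_inv (by positivity) hr0.ne']; field_simp
  calc _ = l * ((((Finset.Icc 1 N).filter fun n => l < ‖f n‖).card : ℝ) * τ) ^ r⁻¹ := by
        rw [Real.mul_rpow (by positivity) hτ.le, mul_assoc]
    _ ≤ l * (S₁.card * τ + S₂.card * τ) ^ r⁻¹ := by
        rw [← add_mul]
        gcongr
    _ ≤ l * ((S₁.card * τ) ^ r⁻¹ + (S₂.card * τ) ^ r⁻¹) := by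
        gcongr
        exact Real.rpow_add_le_add_rpow (by positivity) (by positivity) (by positivity)
          (inv_le_one_of_one_le₀ hr)
    _ ≤ _ := by linarith

end Norms

/-! ### Comparison with the real interpolation norm -/

section Interpolation

variable {X : Type*} [NormedAddCommGroup X] [NormedSpace ℂ X] (A : X →ₗ.[ℂ] X)

/-- K is nondecreasing, so its value at the left endpoint bounds it below on the interval. There s ≤
(2t)^α because τ ≤ t, and the interval has length at least τt^{α−1}. -/
theorem mul_rpow_kFunctional_le_lintegral {r α κ θ t τ : ℝ} (hr : 1 ≤ r) (hα : 1 < α)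
    (hκ : 0 ≤ κ) (hθ : θ = κ / α - r⁻¹ / α) (hτ : 0 < τ) (htτ : τ ≤ t) (x : X) :
    ENNReal.ofReal (τ * (t ^ (-κ) * kFunctional A (t ^ α) x) ^ r)
      ≤ ENNReal.ofReal (2 ^ (κ * r - 1 + α)) *
        ∫⁻ s in Set.Ioc (t ^ α) ((t + τ) ^ α),
          ENNReal.ofReal (s ^ (-θ) * kFunctional A s x) ^ r * ENNReal.ofReal s⁻¹ := by
  have ht : 0 < t := hτ.trans_le htτ
  have hr0 : 0 < r := by linarith
  have hα0 : 0 < α := by linarith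
  have htα : 0 < t ^ α := Real.rpow_pos_of_pos ht _
  -- Chosen so that θr + 1 = e/α: the integrand is s^{-e/α}K(s, x)^r, with a decreasing weight since
  -- e > 0.
  set e := κ * r - 1 + α with he
  have he0 : 0 < e := by have := mul_nonneg hκ hr0.le; linarith
  set K := kFunctional A (t ^ α) x with hK
  have hK0 : 0 ≤ K := kFunctional_nonneg A htα.le x
  have hlow : ∀ s ∈ Set.Ioc (t ^ α) ((t + τ) ^ α),
      ENNReal.ofReal ((2 * t) ^ (-e) * K ^ r)
        ≤ ENNReal.ofReal (s ^ (-θ) * kFunctional A s x) ^ r * ENNReal.ofReal s⁻¹ := by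
    intro s hs
    have hs0 : 0 < s := htα.trans hs.1
    have hKs : K ≤ kFunctional A s x := kFunctional_mono A htα.le hs.1.le x
    have hKs0 : 0 ≤ kFunctional A s x := hK0.trans hKs
    rw [ENNReal.ofReal_rpow_of_nonneg (by positivity) hr0.le,
      ← ENNReal.ofReal_mul (by positivity)]
    refine ENNReal.ofReal_le_ofReal ?_
    have e1 : (s ^ (-θ) * kFunctional A s x) ^ r * s⁻¹
        = s ^ (-(e / α)) * kFunctional A s x ^ r := by
      rw [Real.mul_rpow (by positivity) hKs0, ← Real.rpow_mul hs0.le, mul_right_comm]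
      congr 1
      rw [← Real.rpow_neg_one, ← Real.rpow_add hs0]
      congr 1
      rw [hθ, he]; field_simp; ring
    rw [e1]
    gcongr
    have h1 : s ≤ (2 * t) ^ α := hs.2.trans (by gcongr; linarith)
    calc (2 * t) ^ (-e) = ((2 * t) ^ α) ^ (-(e / α)) := by
          rw [← Real.rpow_mul (by positivity)]; congr 1; field_simp
      _ ≤ _ := Real.rpow_le_rpow_of_nonpos hs0 h1 (by have := div_pos he0 hα0; linarith)
  have hlen : τ * t ^ (α - 1) ≤ (t + τ) ^ α - t ^ α := by
    have h1 : (t + τ) ^ α = (t + τ) * (t + τ) ^ (α - 1) := by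
      rw [Real.rpow_sub_one (by positivity)]; field_simp
    have h2 : t ^ α = t * t ^ (α - 1) := by
      rw [Real.rpow_sub_one ht.ne']; field_simp
    have h3 : t ^ (α - 1) ≤ (t + τ) ^ (α - 1) :=
      Real.rpow_le_rpow ht.le (by linarith) (by linarith)
    rw [h1, h2]
    nlinarith
  have hint : ENNReal.ofReal ((2 * t) ^ (-e) * K ^ r) * ENNReal.ofReal (τ * t ^ (α - 1))
      ≤ ∫⁻ s in Set.Ioc (t ^ α) ((t + τ) ^ α),
          ENNReal.ofReal (s ^ (-θ) * kFunctional A s x) ^ r * ENNReal.ofReal s⁻¹ := by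
    calc _ ≤ ENNReal.ofReal ((2 * t) ^ (-e) * K ^ r) *
          MeasureTheory.volume (Set.Ioc (t ^ α) ((t + τ) ^ α)) := by
          rw [Real.volume_Ioc]; gcongr
      _ = ∫⁻ _ in Set.Ioc (t ^ α) ((t + τ) ^ α), ENNReal.ofReal ((2 * t) ^ (-e) * K ^ r) :=
          (MeasureTheory.setLIntegral_const _ _).symm
      _ ≤ _ := MeasureTheory.setLIntegral_mono' measurableSet_Ioc hlow
  refine le_trans (le_of_eq ?_) (mul_le_mul_right hint _)
  rw [← ENNReal.ofReal_mul (by positivity), ← ENNReal.ofReal_mul (by positivity)]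
  congr 1
  have e1 : (t ^ (-κ)) ^ r = t ^ (-e) * t ^ (α - 1) := by
    rw [← Real.rpow_mul ht.le, ← Real.rpow_add ht]; congr 1; rw [he]; ring
  have e2 : (2 : ℝ) ^ e * 2 ^ (-e) = 1 := by rw [← Real.rpow_add two_pos]; simp
  rw [Real.mul_rpow (by positivity) hK0, e1, Real.mul_rpow two_pos.le ht.le]
  linear_combination (-(τ * t ^ (-e) * t ^ (α - 1) * K ^ r)) * e2

/-- The constant in `LpNorm_kFunctional_le`. -/
def interpConst (p : ℝ≥0∞) (α κ : ℝ) : ℝ :=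
  (2 ^ (κ * p.toReal - 1 + α)) ^ p.toReal⁻¹

theorem interpConst_nonneg (p : ℝ≥0∞) (α κ : ℝ) : 0 ≤ interpConst p α κ := by
  unfold interpConst; positivity

/-- The discrete trace norm is dominated by the norm of the real interpolation space. -/
theorem LpNorm_kFunctional_le {p : ℝ≥0∞} (hp : 1 ≤ p) {α κ θ τ : ℝ} (hα : 1 < α)
    (hκ : 0 ≤ κ) (hθ : θ = κ / α - p⁻¹.toReal / α) (hτ : 0 < τ) (x : X) (N : ℕ) :
    LpNorm p τ N (fun n : ℕ => (n * τ) ^ (-κ) * kFunctional A ((n * τ) ^ α) x)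
      ≤ ENNReal.ofReal (interpConst p α κ) * interpNorm A θ p x := by
  have hα0 : 0 < α := by linarith
  by_cases hpt : p = ∞
  · subst hpt
    simp only [ENNReal.inv_top, ENNReal.toReal_zero, zero_div, sub_zero] at hθ
    -- At p = ∞ the conventions `toReal ∞ = 0` and `0⁻¹ = 0` make the constant 1; the supremum is
    -- merely sampled at s = t_n^α.
    simp only [interpConst, ENNReal.toReal_top, inv_zero, Real.rpow_zero, ENNReal.ofReal_one,
      one_mul, LpNorm, interpNorm, if_true]
    refine iSup₂_le fun n hn => ?_
    have hnτ : 0 < (n : ℝ) * τ := by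
      have : (0 : ℝ) < n := by exact_mod_cast (Finset.mem_Icc.1 hn).1
      positivity
    have htα : 0 < ((n : ℝ) * τ) ^ α := Real.rpow_pos_of_pos hnτ _
    refine le_trans (le_of_eq ?_) (le_iSup₂ (((n : ℝ) * τ) ^ α) htα)
    rw [Real.enorm_of_nonneg (mul_nonneg (by positivity) (kFunctional_nonneg A htα.le x)),
      ← Real.rpow_mul hnτ.le, hθ]
    congr 3
    field_simp
  · have hr : 1 ≤ p.toReal := by
      rw [← ENNReal.toReal_one]; exact ENNReal.toReal_mono hpt hp
    rw [ENNReal.toReal_inv] at hθ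
    simp only [interpConst, LpNorm, interpNorm, if_neg hpt]
    set r := p.toReal
    have hr0 : 0 < r := by linarith
    rw [← ENNReal.ofReal_rpow_of_nonneg (by positivity) (by positivity),
      ← ENNReal.mul_rpow_of_nonneg _ _ (by positivity : 0 ≤ r⁻¹)]
    refine ENNReal.rpow_le_rpow ?_ (by positivity)
    set I : ℕ → Set ℝ := fun n => Set.Ioc (((n : ℝ) * τ) ^ α) (((n : ℝ) * τ + τ) ^ α) with hI
    set F : ℝ → ℝ≥0∞ := fun s =>
      ENNReal.ofReal (s ^ (-θ) * kFunctional A s x) ^ r * ENNReal.ofReal s⁻¹ with hF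
    have hmono : Monotone fun n : ℕ => ((n : ℝ) * τ) ^ α := fun m n h => by
      have : (m : ℝ) ≤ n := by exact_mod_cast h
      exact Real.rpow_le_rpow (by positivity) (by gcongr) hα0.le
    have hdisj : Pairwise (Function.onFun Disjoint I) := by
      have := hmono.pairwise_disjoint_on_Ioc_succ
      convert this using 4 with n
      simp only [Order.succ_eq_add_one]
      congr 2
      push_cast; ring
    calc _ = ∑ n ∈ Finset.Icc 1 N, ENNReal.ofReal
          (τ * ((n * τ) ^ (-κ) * kFunctional A ((n * τ) ^ α) x) ^ r) := by
          rw [mul_sum]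
          refine sum_congr rfl fun n _ => ?_
          have hk : 0 ≤ kFunctional A (((n : ℝ) * τ) ^ α) x :=
            kFunctional_nonneg A (by positivity) x
          rw [ENNReal.ofReal_mul hτ.le, Real.enorm_of_nonneg (by positivity),
            ENNReal.ofReal_rpow_of_nonneg (by positivity) hr0.le]
      _ ≤ ∑ n ∈ Finset.Icc 1 N, ENNReal.ofReal (2 ^ (κ * r - 1 + α)) * ∫⁻ s in I n, F s := by
          refine sum_le_sum fun n hn => ?_
          refine mul_rpow_kFunctional_le_lintegral A hr hα hκ hθ hτ ?_ x
          have : (1 : ℝ) ≤ n := by exact_mod_cast (Finset.mem_Icc.1 hn).1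
          nlinarith
      _ = ENNReal.ofReal (2 ^ (κ * r - 1 + α)) * ∫⁻ s in ⋃ n ∈ Finset.Icc 1 N, I n, F s := by
          rw [← mul_sum, MeasureTheory.lintegral_biUnion_finset
            (fun m _ n _ h => hdisj h) fun n _ => measurableSet_Ioc]
      _ ≤ _ := by
          gcongr
          refine Set.iUnion₂_subset fun n _ s hs => ?_
          exact lt_of_le_of_lt (Real.rpow_nonneg (by positivity) _) hs.1

end Interpolation

/-! ### Assembling the three estimates -/

theorem add_self_le_ofReal_mul {L I J : ℝ≥0∞} {C a b S : ℝ} (hC : 0 ≤ C)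
    (ha : a ≤ S) (hb : b ≤ S)
    (h : L ≤ ENNReal.ofReal C * (ENNReal.ofReal a * I + ENNReal.ofReal b * J)) :
    L + L ≤ ENNReal.ofReal (2 * C * S) * (I + J) := by
  have h1 : L ≤ ENNReal.ofReal C * (ENNReal.ofReal S * (I + J)) := by
    refine h.trans ?_
    rw [mul_add (ENNReal.ofReal S)]
    gcongr
  rw [ENNReal.ofReal_mul (by positivity), ENNReal.ofReal_mul two_pos.le, ENNReal.ofReal_ofNat,
    mul_assoc, mul_assoc, two_mul]
  exact add_le_add h1 h1

/-- The constant in the maximal regularity estimates. -/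
def regularityConst (p : ℝ≥0∞) (α M : ℝ) : ℝ :=
  2 * (2 * schemeConst α M) * (interpConst p α α + interpConst p α (α - 1)
    + |(1 - (α - 1) * p.toReal)⁻¹ ^ p.toReal⁻¹| + 1)

end FracBE

end

theorem theorem7p2 (α : ℝ) (hα1 : 1 < α) (hα2 : α < 2) (p : ℝ≥0∞) (hp : 1 ≤ p) (M : ℝ) :
    ∃ c : ℝ≥0, ∀ (X : Type*) [NormedAddCommGroup X] [NormedSpace ℂ X] [CompleteSpace X]
      (A : X →ₗ.[ℂ] X), FracBE.IsSectorial A (α * Real.pi / 2) →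
      FracBE.ResolventBound A (α * Real.pi / 2) M →
      ∀ (τ : ℝ), 0 < τ → ∀ (v w : X) (u : ℕ → X), FracBE.IsBESolution A α τ v w u → ∀ N : ℕ,
      (p < ENNReal.ofReal (1 / (α - 1)) →
        FracBE.LpNorm p τ N (FracBE.caputoBE α τ v w u)
            + FracBE.LpNorm p τ N (fun n => FracBE.opVal A (u n))
          ≤ c * (FracBE.interpNorm A (1 - p⁻¹.toReal / α) p v
              + ENNReal.ofReal ((N * τ) ^ (p⁻¹.toReal - (α - 1))) * ‖w‖ₑ)) ∧
      (ENNReal.ofReal (1 / (α - 1)) < p →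
        FracBE.LpNorm p τ N (FracBE.caputoBE α τ v w u)
            + FracBE.LpNorm p τ N (fun n => FracBE.opVal A (u n))
          ≤ c * (FracBE.interpNorm A (1 - p⁻¹.toReal / α) p v
              + FracBE.interpNorm A (1 - 1 / α - p⁻¹.toReal / α) p w)) ∧
      (p = ENNReal.ofReal (1 / (α - 1)) →
        FracBE.weakLpNorm p.toReal τ N (FracBE.caputoBE α τ v w u)
            + FracBE.weakLpNorm p.toReal τ N (fun n => FracBE.opVal A (u n))
          ≤ c * (FracBE.interpNorm A (1 - p⁻¹.toReal / α) p v + ‖w‖ₑ)) := by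
  refine ⟨(FracBE.regularityConst p α M).toNNReal, ?_⟩
  intro X _ _ _ A hA hM τ hτ v w u hu N
  -- The coercion of `Real.toNNReal` to `ℝ≥0∞` is `ENNReal.ofReal` by definition.
  change (_ → _ ≤ ENNReal.ofReal _ * _) ∧ (_ → _ ≤ ENNReal.ofReal _ * _) ∧
    (_ → _ ≤ ENNReal.ofReal _ * _)
  have hα0 : 0 < α := by linarith
  have hC := FracBE.schemeConst_nonneg α M hα2
  have hc₁ := FracBE.interpConst_nonneg p α α
  have hc₂ := FracBE.interpConst_nonneg p α (α - 1)
  have hc₃ := abs_nonneg ((1 - (α - 1) * p.toReal)⁻¹ ^ p.toReal⁻¹)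
  have hD := fun n (hn : 1 ≤ n) => hu.norm_caputoBE_le hα1 hα2 hτ hA hM hn
  have hK : ∀ (x : X) (n : ℕ), 0 ≤ FracBE.kFunctional A ((n * τ) ^ α) x := fun x n =>
    FracBE.kFunctional_nonneg A (by positivity) x
  have hDn : ∀ n : ℕ, 1 ≤ n → ‖FracBE.caputoBE α τ v w u n‖ ≤ FracBE.schemeConst α M *
      ((n * τ) ^ (-α) * FracBE.kFunctional A ((n * τ) ^ α) v + (n * τ) ^ (-(α - 1)) * ‖w‖) :=
    fun n hn => by
      have h0 := min_le_right (FracBE.kFunctional A ((n * τ) ^ α) w) ‖w‖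
      exact (hD n hn).trans (by gcongr)
  have hDk : ∀ n : ℕ, 1 ≤ n → ‖FracBE.caputoBE α τ v w u n‖ ≤ FracBE.schemeConst α M *
      ((n * τ) ^ (-α) * FracBE.kFunctional A ((n * τ) ^ α) v
        + (n * τ) ^ (-(α - 1)) * FracBE.kFunctional A ((n * τ) ^ α) w) :=
    fun n hn => by
      have h0 := min_le_left (FracBE.kFunctional A ((n * τ) ^ α) w) ‖w‖
      exact (hD n hn).trans (by gcongr)
  have hv := FracBE.LpNorm_kFunctional_le A hp hα1 hα0.le
    (θ := 1 - p⁻¹.toReal / α) (by rw [div_self hα0.ne']) hτ v N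
  refine ⟨fun h => ?_, fun _ => ?_, fun h => ?_⟩
  · have hpt : p ≠ ∞ := (h.trans ENNReal.ofReal_lt_top).ne
    have hq : (α - 1) * p.toReal < 1 := by
      have h1 := ENNReal.toReal_lt_of_lt_ofReal h
      rw [lt_div_iff₀ (by linarith)] at h1
      linarith
    have hw := FracBE.LpNorm_rpow_mul_le hp hpt hτ (κ := α - 1) (by linarith) hq (norm_nonneg w) N
    rw [ofReal_norm] at hw
    rw [← FracBE.LpNorm_congr (f := FracBE.caputoBE α τ v w u) hu.scheme]
    -- One constant serves all three cases. Its absolute value is there because 1 − (α − 1)p is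
    -- positive only in this case, so elsewhere the real power could be negative.
    refine FracBE.add_self_le_ofReal_mul (C := 2 * FracBE.schemeConst α M) (by positivity)
      (a := FracBE.interpConst p α α) (by linarith) (b := _)
      ((le_abs_self ((1 - (α - 1) * p.toReal)⁻¹ ^ p.toReal⁻¹)).trans (by linarith)) ?_
    refine (FracBE.LpNorm_le_of_norm_le hp hC
      (a := fun n : ℕ => (n * τ) ^ (-α) * FracBE.kFunctional A ((n * τ) ^ α) v)
      (b := fun n : ℕ => (n * τ) ^ (-(α - 1)) * ‖w‖)
      (fun n => mul_nonneg (by positivity) (hK v n)) (fun n => by positivity) hDn).trans ?_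
    gcongr
    linarith
  · have hw := FracBE.LpNorm_kFunctional_le A hp hα1 (κ := α - 1) (by linarith)
      (θ := 1 - 1 / α - p⁻¹.toReal / α) (by field_simp) hτ w N
    rw [← FracBE.LpNorm_congr (f := FracBE.caputoBE α τ v w u) hu.scheme]
    refine FracBE.add_self_le_ofReal_mul (C := 2 * FracBE.schemeConst α M) (by positivity)
      (a := FracBE.interpConst p α α) (by linarith) (b := FracBE.interpConst p α (α - 1))
      (by linarith) ?_
    refine (FracBE.LpNorm_le_of_norm_le hp hC
      (a := fun n : ℕ => (n * τ) ^ (-α) * FracBE.kFunctional A ((n * τ) ^ α) v)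
      (b := fun n : ℕ => (n * τ) ^ (-(α - 1)) * FracBE.kFunctional A ((n * τ) ^ α) w)
      (fun n => mul_nonneg (by positivity) (hK v n))
      (fun n => mul_nonneg (by positivity) (hK w n)) hDk).trans ?_
    gcongr
    linarith
  · have hpt : p ≠ ∞ := h ▸ ENNReal.ofReal_ne_top
    -- At the critical exponent t^{-(α−1)} is t^{-1/p}, the model function of weak L^p.
    have hr : p.toReal⁻¹ = α - 1 := by
      rw [h, ENNReal.toReal_ofReal (one_div_nonneg.2 (by linarith)), one_div, inv_inv]
    rw [← FracBE.weakLpNorm_congr (f := FracBE.caputoBE α τ v w u) hu.scheme]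
    refine FracBE.add_self_le_ofReal_mul (C := 2 * FracBE.schemeConst α M) (by positivity)
      (a := FracBE.interpConst p α α) (by linarith) (b := 1) (by linarith) ?_
    refine (FracBE.weakLpNorm_le_of_norm_le hp hpt hτ hC (norm_nonneg w)
      (a := fun n : ℕ => (n * τ) ^ (-α) * FracBE.kFunctional A ((n * τ) ^ α) v)
      (fun n => mul_nonneg (by positivity) (hK v n)) (by rw [hr]; exact hDn)).trans ?_
    rw [ofReal_norm, ENNReal.ofReal_one, one_mul]
    gcongr
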